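/- Let $\eta$ be a meromorphic $1$-form on $\mathbb P^1=\mathbb P^1(\mathbb C)$ with pole set $(\eta)_\infty$, and let $\mathcal F$ be the singular holomorphic foliation of $\mathbb P^1\times\mathbb P^1$ defined by the meromorphic closed $1$-form $\omega$ whose expression in the affine chart is $\omega(x,y)=dx-\eta(y)$, $(x,y)\in\mathbb C^2$. Let $F_0=\{x_0\}\times\mathbb P^1$ and $F_1=\{x_1\}\times\mathbb P^1$ be fibres of $dx=0$. A germ $h:(F_0,p_0)\to(F_1,p_1)$ is called an *admissible germ* for $\mathcal F$ if it is the holonomy germ of a leafwise path: $p_0$ and $p_1$ are regular points of $\mathcal F$ at which $F_0$, respectively $F_1$, is transverse to $\mathcal F$, and there is a continuous family of leafwise paths $\gamma^p:[0,1]\to\mathbb P^1\times\mathbb P^1$, parametrized by the points $p\in F_0$ close to $p_0$, such that $\gamma^p(0)=p$ and $\gamma^p(1)=h(p)\in F_1$. Let $h$ be an admissible germ for $\mathcal F$ from $F_0$ to $F_1$ at $p_0$, and let $\tau:[0,1]\to F_0\cong\mathbb P^1$ be a path with $\tau(0)=p_0$ that avoids $(\eta)_\infty$, along which $h$ has an analytic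 continuation $(h_t)_{t\in[0,1]}$ by germs of holomorphic maps $h_t$ from $F_0$ to $F_1$ at $\tau(t)$. Suppose that $h_1$ is the germ of a biholomorphism at $\tau(1)$. Then $h_1$ is realized by a continuous family of leafwise paths as above (parametrized by the points $p\in F_0$ close to $\tau(1)$, from $p$ to $h_1(p)$); and if $F_0$ is transverse to $\mathcal F$ at $\tau(1)$, then $h_1$ is an admissible germ for $\mathcal F$. -/

import Mathlib

open Filter Topology Set
open scoped Manifold ContDiff unitInterval

/-! ### The complex projective line as a complex manifold -/

/-- The complex projective line `ℂ ∪ {∞}`, with the topology of the one-point compactification. -/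
abbrev P1 : Type := OnePoint ℂ

namespace P1

/-- The standard affine coordinate (with the dummy value `0` at `∞`). -/
def coord (p : P1) : ℂ := p.elim 0 id

@[simp] theorem coord_coe (z : ℂ) : coord (z : P1) = z := rfl

@[simp] theorem coord_infty : coord (OnePoint.infty : P1) = 0 := rfl

open Classical in
/-- The involution `z ↦ 1 / z` of the projective line, exchanging `0` and `∞`. -/
noncomputable def inv (p : P1) : P1 :=
  p.elim ((0 : ℂ) : P1) (fun z => if z = 0 then OnePoint.infty else ((z⁻¹ : ℂ) : P1))

@[simp] theorem inv_infty : inv OnePoint.infty = ((0 : ℂ) : P1) := rfl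

@[simp] theorem inv_zero : inv ((0 : ℂ) : P1) = OnePoint.infty := by simp [inv]

theorem inv_coe {z : ℂ} (hz : z ≠ 0) : inv (z : P1) = ((z⁻¹ : ℂ) : P1) := by simp [inv, hz]

@[simp] theorem inv_inv (p : P1) : inv (inv p) = p := by
  induction p using OnePoint.rec with
  | infty => simp
  | coe z =>
    by_cases hz : z = 0
    · subst hz; simp
    · rw [inv_coe hz, inv_coe (inv_ne_zero hz), _root_.inv_inv]

theorem continuous_inv : Continuous inv := by
  rw [continuous_iff_continuousAt]
  intro p
  induction p using OnePoint.rec with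
  | infty =>
    rw [OnePoint.continuousAt_infty', inv_infty, Filter.coclosedCompact_eq_cocompact,
      ← Metric.cobounded_eq_cocompact]
    have h : Tendsto (fun z : ℂ => ((z⁻¹ : ℂ) : P1)) (Bornology.cobounded ℂ) (𝓝 ((0 : ℂ) : P1)) :=
      (OnePoint.continuous_coe.tendsto 0).comp tendsto_inv₀_cobounded
    refine h.congr' ?_
    filter_upwards [Bornology.eventually_ne_cobounded (0 : ℂ)] with z hz
    exact (inv_coe hz).symm
  | coe z =>
    rw [OnePoint.continuousAt_coe]
    by_cases hz : z = 0
    · subst hz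
      have h : Tendsto (fun z : ℂ => ((z⁻¹ : ℂ) : P1)) (𝓝[≠] 0) (𝓝 OnePoint.infty) := by
        have h1 : Tendsto ((↑) : ℂ → P1) (coclosedCompact ℂ) (𝓝 OnePoint.infty) :=
          OnePoint.tendsto_coe_infty
        rw [Filter.coclosedCompact_eq_cocompact, ← Metric.cobounded_eq_cocompact] at h1
        exact h1.comp tendsto_inv₀_nhdsNE_zero
      rw [continuousAt_iff_punctured_nhds]
      simp only [Function.comp_apply, inv_zero]
      refine h.congr' ?_
      filter_upwards [self_mem_nhdsWithin] with w hw
      exact (inv_coe hw).symm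
    · have h : ContinuousAt (fun z : ℂ => ((z⁻¹ : ℂ) : P1)) z :=
        OnePoint.continuous_coe.continuousAt.comp (continuousAt_inv₀ hz)
      refine h.congr ?_
      filter_upwards [isOpen_ne.mem_nhds hz] with w hw
      exact (inv_coe hw).symm

/-- The involution `z ↦ 1 / z` as a homeomorphism. -/
noncomputable def invHomeomorph : P1 ≃ₜ P1 where
  toFun := inv
  invFun := inv
  left_inv := inv_inv
  right_inv := inv_inv
  continuous_toFun := continuous_inv
  continuous_invFun := continuous_inv

/-- The chart `ℂ ⊆ P1` with coordinate `z`. -/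
noncomputable def affineChart : OpenPartialHomeomorph P1 ℂ where
  toFun := coord
  invFun := fun z => (z : P1)
  source := {OnePoint.infty}ᶜ
  target := univ
  map_source' := fun _ _ => mem_univ _
  map_target' := fun z _ => OnePoint.coe_ne_infty z
  left_inv' := by
    intro p hp
    induction p using OnePoint.rec with
    | infty => exact absurd rfl hp
    | coe z => rfl
  right_inv' := fun _ _ => rfl
  open_source := isOpen_compl_singleton
  open_target := isOpen_univ
  continuousOn_toFun := by
    intro p hp
    induction p using OnePoint.rec with
    | infty => exact absurd rfl hp
    | coe z =>
      refine ContinuousAt.continuousWithinAt ?_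
      rw [OnePoint.continuousAt_coe]
      exact continuousAt_id
  continuousOn_invFun := OnePoint.continuous_coe.continuousOn

/-- The chart `P1 \ {0}` with coordinate `w = 1 / z`, which vanishes at `∞`. -/
noncomputable def inftyChart : OpenPartialHomeomorph P1 ℂ :=
  invHomeomorph.toOpenPartialHomeomorph.trans affineChart

open Classical in
noncomputable instance : ChartedSpace ℂ P1 where
  atlas := {affineChart, inftyChart}
  chartAt := fun p => if p = OnePoint.infty then inftyChart else affineChart
  mem_chart_source := by
    intro p
    by_cases hp : p = OnePoint.infty
    · subst hp
      simp only [if_true]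
      simp [inftyChart, affineChart, invHomeomorph]
    · simp only [if_neg hp]
      exact hp
  chart_mem_atlas := by
    intro p
    by_cases hp : p = OnePoint.infty <;> simp [hp]

instance : IsManifold 𝓘(ℂ, ℂ) ω P1 := by
  have key : ∀ e : OpenPartialHomeomorph ℂ ℂ, (∀ z ∈ e.source, z ≠ 0 ∧ e z = z⁻¹) →
      ContDiffOn ℂ ω e e.source := by
    intro e he
    have h : ContDiffOn ℂ ω (fun z : ℂ => z⁻¹) e.source :=
      fun z hz => (contDiffAt_inv ℂ (he z hz).1).contDiffWithinAt
    exact h.congr fun z hz => (he z hz).2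
  have key' : ∀ e : OpenPartialHomeomorph ℂ ℂ, (∀ z ∈ e.source, e z = z) →
      ContDiffOn ℂ ω e e.source := fun e he => contDiffOn_id.congr he
  refine isManifold_of_contDiffOn _ _ _ ?_
  intro e e' he he'
  suffices h : ContDiffOn ℂ ω (e.symm.trans e') (e.symm.trans e').source by
    simpa using h
  have hsrc : ∀ z : ℂ, inv (z : P1) ≠ OnePoint.infty → z ≠ 0 := by
    rintro z hz rfl
    exact hz inv_zero
  rcases he with rfl | rfl <;> rcases he' with rfl | rfl
  · refine key' _ fun z _ => rfl
  · refine key _ fun z hz => ?_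
    have hz0 : z ≠ 0 := hsrc z hz.2.2
    refine ⟨hz0, ?_⟩
    change coord (inv (z : P1)) = z⁻¹
    rw [inv_coe hz0, coord_coe]
  · refine key _ fun z hz => ?_
    have hz0 : z ≠ 0 := hsrc z hz.2
    refine ⟨hz0, ?_⟩
    change coord (inv (z : P1)) = z⁻¹
    rw [inv_coe hz0, coord_coe]
  · refine key' _ fun z _ => ?_
    change coord (inv (inv (z : P1))) = z
    rw [inv_inv, coord_coe]

end P1

/-! ### Meromorphic 1-forms on the projective line -/

/-- A meromorphic 1-form `η` on the projective line: `η = coeff(y) dy` in the affine coordinate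
`y` and, in the coordinate `w = 1 / y` at `∞`, `η = - coeff(1 / w) / w ^ 2 dw`. The values of
`coeff` on a discrete set are irrelevant. -/
structure MeromorphicOneForm where
  coeff : ℂ → ℂ
  meromorphic : Meromorphic coeff
  meromorphicAt_infty : MeromorphicAt (fun w : ℂ => - coeff w⁻¹ / w ^ 2) 0

namespace MeromorphicOneForm

/-- The coefficient of `η` in the coordinate `w = 1 / y` at `∞`. -/
noncomputable def coeffInfty (η : MeromorphicOneForm) (w : ℂ) : ℂ := - η.coeff w⁻¹ / w ^ 2

/-- The pole set `(η)_∞` of `η` in the projective line. -/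
def poles (η : MeromorphicOneForm) : Set P1 :=
  {p | (∃ y : ℂ, p = (y : P1) ∧ meromorphicOrderAt η.coeff y < 0) ∨
    (p = OnePoint.infty ∧ meromorphicOrderAt η.coeffInfty 0 < 0)}

end MeromorphicOneForm

/-! ### The foliation `dx - η(y) = 0` on `P1 × P1` -/

section Foliation

variable (η : MeromorphicOneForm)

/-- `f` is a local submersion defining the foliation `dx - η(y) = 0` near the point `p`: it is
holomorphic near `p`, its differential does not vanish at `p`, and at the points `(x, y) ∈ ℂ²` near
`p` at which `dx - η(y)` is holomorphic, the differential of `f` vanishes on the kernel of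
`dx - η(y)`. The fibres of `f` near `p` are the plaques of the (saturated) foliation. Such an `f`
exists precisely if `p` is a regular point of the foliation. -/
def IsLocalFirstIntegral (p : P1 × P1) (f : P1 × P1 → ℂ) : Prop :=
  ContMDiffAt (𝓘(ℂ, ℂ).prod 𝓘(ℂ, ℂ)) 𝓘(ℂ, ℂ) ω f p ∧
  mfderiv (𝓘(ℂ, ℂ).prod 𝓘(ℂ, ℂ)) 𝓘(ℂ, ℂ) f p ≠ 0 ∧
  ∀ᶠ q in 𝓝 p, ∀ x y : ℂ, q = ((x : P1), (y : P1)) → AnalyticAt ℂ η.coeff y →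
    ∀ v : ℂ × ℂ, v.1 - η.coeff y * v.2 = 0 →
      fderiv ℂ (fun z : ℂ × ℂ => f ((z.1 : P1), (z.2 : P1))) (x, y) v = 0

/-- The point `(x, y)` is a regular point of the foliation, and the fibre `{x} × P1` of `dx = 0` is
transverse to the foliation there. -/
def IsTransverseAt (x y : P1) : Prop :=
  ∃ f : P1 × P1 → ℂ, IsLocalFirstIntegral η (x, y) f ∧
    mfderiv 𝓘(ℂ, ℂ) 𝓘(ℂ, ℂ) (fun y' : P1 => f (x, y')) y ≠ 0

/-- A leafwise path: a continuous path in the regular set of the foliation that locally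
stays in a plaque. -/
def IsLeafwisePath (γ : I → P1 × P1) : Prop :=
  Continuous γ ∧
  ∀ t : I, ∃ f : P1 × P1 → ℂ, IsLocalFirstIntegral η (γ t) f ∧ ∀ᶠ s in 𝓝 t, f (γ s) = f (γ t)

/-- The germ at `y₀` of `h : {x₀} × P1 → {x₁} × P1` is realized by transport along leaves: there is
a continuous family of leafwise paths `Γ y`, parametrized by the points `y` near `y₀`, such that
`Γ y` goes from `(x₀, y)` to `(x₁, h y)`. -/
def IsLeafwiseTransport (x₀ x₁ y₀ : P1) (h : P1 → P1) : Prop :=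
  ∃ U ∈ 𝓝 y₀, ∃ Γ : P1 → I → P1 × P1,
    ContinuousOn (fun z : P1 × I => Γ z.1 z.2) (U ×ˢ univ) ∧
    ∀ y ∈ U, IsLeafwisePath η (Γ y) ∧ Γ y 0 = (x₀, y) ∧ Γ y 1 = (x₁, h y)

/-- The germ at `y₀` of `h : {x₀} × P1 → {x₁} × P1` is an admissible germ for the foliation, that
is, the holonomy germ `h_γ` of some leafwise path `γ` from `(x₀, y₀)` to `(x₁, h y₀)`, the two
fibres being transverse to the foliation at these points. (The path `γ` is the member at `y₀`
of the family of leafwise paths.) -/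
def IsAdmissibleGerm (x₀ x₁ y₀ : P1) (h : P1 → P1) : Prop :=
  IsTransverseAt η x₀ y₀ ∧ IsTransverseAt η x₁ (h y₀) ∧ IsLeafwiseTransport η x₀ x₁ y₀ h

end Foliation

/-- `H` is an analytic continuation along the path `τ` of the germ at `τ 0` of `h`, by germs of
holomorphic maps: `H t` represents the germ at `τ t`. -/
def IsAnalyticContinuation (τ : C(I, P1)) (h : P1 → P1) (H : I → P1 → P1) : Prop :=
  H 0 =ᶠ[𝓝 (τ 0)] h ∧
  (∀ t, ContMDiffAt 𝓘(ℂ, ℂ) 𝓘(ℂ, ℂ) ω (H t) (τ t)) ∧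
  ∀ t, ∀ᶠ s in 𝓝 t, H s =ᶠ[𝓝 (τ s)] H t

/-! Where `x` is finite and `η` is holomorphic at `y`, the leaves are the level sets of `x - G(y)`,
with `G` a local primitive of `η`. The remaining points lie on the line `{∞} × P1` and on the lines
over the poles of `η`; these are invariant by the foliation, so a leafwise path that starts off them
never reaches them (`IsLeafwisePath.isHorizontal`).

Along such a path `dx = η(y)`. Comparing the paths of a continuous family whose ends have fixed `x`,
one finds `K ∘ h - G` locally constant for primitives `G` at the source and `K` at the target:
holonomy satisfies `h^*η = η` (`IsLeafwiseTransport.preserves`). This equation between meromorphic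
forms propagates along the analytic continuation by the identity theorem
(`eventually_preservedAt_iff`). It also keeps the values of the continued germs away from the poles,
since a nonconstant map pulls a pole back to a pole. Nonconstancy holds because transversality at
the initial point excludes `η = 0`.

Conversely, suppose that `H^*η = η` near `p` and that one leafwise path `γ` joins `(x₀, q)` to `(x₁,
H q)` for some `q` near `p`. For a nearby `v`, follow the leaf over a segment from `v` to `q`, then
`γ` translated in `x`, then the leaf over the `H`-image of the reversed segment. Constancy of `K ∘ H
- G` says exactly that this ends at `(x₁, H v)` (`exists_nhds_isLeafwiseTransport`). So the
existence of a path to the image of `τ t` is locally constant in `t`, and holds up to `t = 1`.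
Transversality means `dG ≠ 0` (`isTransverseAt_iff`), and `K ∘ H = G + const` carries it to the
target. -/

/-! ### Two standard coordinates on the projective line -/

namespace P1

/-- The two standard parametrizations `z ↦ z` and `z ↦ 1 / z` of affine pieces of `P1`. -/
noncomputable def param (b : Bool) (z : ℂ) : P1 := bif b then inv (z : P1) else (z : P1)

/-- The coordinates inverse to `P1.param`. -/
noncomputable def coordAt (b : Bool) (p : P1) : ℂ := coord (bif b then inv p else p)

@[simp] theorem param_false (z : ℂ) : param false z = (z : P1) := rfl

@[simp] theorem param_true (z : ℂ) : param true z = inv (z : P1) := rfl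

@[simp] theorem coordAt_false (p : P1) : coordAt false p = coord p := rfl

@[simp] theorem coordAt_true (p : P1) : coordAt true p = coord (inv p) := rfl

@[simp] theorem coordAt_param (b : Bool) (z : ℂ) : coordAt b (param b z) = z := by
  cases b <;> simp

theorem param_injective (b : Bool) : Function.Injective (param b) :=
  Function.LeftInverse.injective (coordAt_param b)

theorem isOpenEmbedding_param (b : Bool) : IsOpenEmbedding (param b) := by
  cases b
  · exact OnePoint.isOpenEmbedding_coe
  · exact invHomeomorph.isOpenEmbedding.comp OnePoint.isOpenEmbedding_coe

theorem nhds_param (b : Bool) (z : ℂ) : 𝓝 (param b z) = map (param b) (𝓝 z) :=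
  ((isOpenEmbedding_param b).map_nhds_eq z).symm

theorem continuous_param (b : Bool) : Continuous (param b) := (isOpenEmbedding_param b).continuous

theorem eventually_nhds_param {b : Bool} {z : ℂ} {P : P1 → Prop} :
    (∀ᶠ q in 𝓝 (param b z), P q) ↔ ∀ᶠ w in 𝓝 z, P (param b w) := by
  rw [nhds_param, eventually_map]

theorem eventually_nhdsNE_param {b : Bool} {z : ℂ} {P : P1 → Prop} :
    (∀ᶠ q in 𝓝[≠] (param b z), P q) ↔ ∀ᶠ w in 𝓝[≠] z, P (param b w) := by
  simp only [eventually_nhdsWithin_iff, eventually_nhds_param, mem_compl_iff, mem_singleton_iff,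
    (param_injective b).eq_iff]

theorem param_coordAt_eventually (b : Bool) (z : ℂ) :
    ∀ᶠ q in 𝓝 (param b z), param b (coordAt b q) = q := by
  rw [eventually_nhds_param]
  exact Eventually.of_forall fun w => by simp

/-- Every point of `P1` is a point of one of the charts; the chart at infinity is only needed
at its origin. -/
theorem exists_param (p : P1) : ∃ b z, (b = true → z = 0) ∧ param b z = p := by
  induction p using OnePoint.rec with
  | infty => exact ⟨true, 0, fun _ => rfl, by simp⟩
  | coe z => exact ⟨false, z, by simp, rfl⟩

theorem contMDiff_param (b : Bool) : ContMDiff 𝓘(ℂ, ℂ) 𝓘(ℂ, ℂ) ω (param b) := by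
  rw [← contMDiffOn_univ]
  cases b
  · have h : ContMDiffOn 𝓘(ℂ, ℂ) 𝓘(ℂ, ℂ) ω _ _ := contMDiffOn_symm_of_mem_maximalAtlas
      (IsManifold.subset_maximalAtlas (show affineChart ∈ atlas ℂ P1 from Or.inl rfl))
    exact h
  · have h : ContMDiffOn 𝓘(ℂ, ℂ) 𝓘(ℂ, ℂ) ω _ _ := contMDiffOn_symm_of_mem_maximalAtlas
      (IsManifold.subset_maximalAtlas (show inftyChart ∈ atlas ℂ P1 from Or.inr rfl))
    refine h.mono ?_
    intro z _
    simp [inftyChart, affineChart]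

theorem contMDiffAt_coordAt (b : Bool) (z : ℂ) :
    ContMDiffAt 𝓘(ℂ, ℂ) 𝓘(ℂ, ℂ) ω (coordAt b) (param b z) := by
  cases b
  · have h : ContMDiffOn 𝓘(ℂ, ℂ) 𝓘(ℂ, ℂ) ω _ _ := contMDiffOn_of_mem_maximalAtlas
      (IsManifold.subset_maximalAtlas (show affineChart ∈ atlas ℂ P1 from Or.inl rfl))
    exact h.contMDiffAt (affineChart.open_source.mem_nhds (OnePoint.coe_ne_infty z))
  · have h : ContMDiffOn 𝓘(ℂ, ℂ) 𝓘(ℂ, ℂ) ω _ _ := contMDiffOn_of_mem_maximalAtlas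
      (IsManifold.subset_maximalAtlas (show inftyChart ∈ atlas ℂ P1 from Or.inr rfl))
    refine h.contMDiffAt (inftyChart.open_source.mem_nhds ?_)
    simp [inftyChart, affineChart, invHomeomorph]

theorem contMDiffAt_iff_analyticAt_comp_param {f : P1 → ℂ} {b : Bool} {z : ℂ} :
    ContMDiffAt 𝓘(ℂ, ℂ) 𝓘(ℂ, ℂ) ω f (param b z) ↔ AnalyticAt ℂ (fun w => f (param b w)) z := by
  have key : AnalyticAt ℂ (fun w => f (param b w)) z ↔
      ContMDiffAt 𝓘(ℂ, ℂ) 𝓘(ℂ, ℂ) ω (fun w => f (param b w)) z :=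
    ⟨fun h => h.contDiffAt.contMDiffAt, fun h => h.contDiffAt.analyticAt⟩
  rw [key]
  constructor
  · intro h
    exact h.comp z (contMDiff_param b z)
  · intro h
    have h1 : ContMDiffAt 𝓘(ℂ, ℂ) 𝓘(ℂ, ℂ) ω (fun q => f (param b (coordAt b q))) (param b z) :=
      ContMDiffAt.comp (g := fun w => f (param b w)) (param b z) (by simpa using h)
        (contMDiffAt_coordAt b z)
    refine h1.congr_of_eventuallyEq ?_
    filter_upwards [param_coordAt_eventually b z] with q hq
    rw [hq]

theorem param_true_of_ne_zero {z : ℂ} (hz : z ≠ 0) : param true z = ((z⁻¹ : ℂ) : P1) := inv_coe hz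

end P1

open P1

/-! ### Analytic functions with vanishing derivative -/

/-- The hypothesis is punctured because the coefficient of `η` may take a meaningless value at the
centre; isolated zeros recover the derivative there. -/
theorem AnalyticAt.eventually_eq_of_deriv_eq_zero {f : ℂ → ℂ} {z : ℂ} (hf : AnalyticAt ℂ f z)
    (h : ∀ᶠ w in 𝓝[≠] z, deriv f w = 0) : ∀ᶠ w in 𝓝 z, f w = f z := by
  have h1 : ∀ᶠ w in 𝓝 z, deriv f w = 0 := hf.deriv.frequently_zero_iff_eventually_zero.1 h.frequently
  obtain ⟨r, hr, hball⟩ := Metric.eventually_nhds_iff_ball.1 (h1.and hf.eventually_analyticAt)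
  filter_upwards [Metric.ball_mem_nhds z hr] with w hw
  exact Metric.isOpen_ball.is_const_of_deriv_eq_zero (convex_ball z r).isPreconnected
    (fun x hx => (hball x hx).2.differentiableAt.differentiableWithinAt)
    (fun x hx => (hball x hx).1) hw (Metric.mem_ball_self hr)

/-! ### Local primitives of a meromorphic form -/

namespace MeromorphicOneForm

variable (η : MeromorphicOneForm)

/-- The coefficient of `η` in the coordinate `P1.coordAt b`. -/
noncomputable def coeffAt (b : Bool) : ℂ → ℂ := bif b then η.coeffInfty else η.coeff

@[simp] theorem coeffAt_false : η.coeffAt false = η.coeff := rfl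

@[simp] theorem coeffAt_true : η.coeffAt true = η.coeffInfty := rfl

theorem meromorphic_coeffAt (b : Bool) : Meromorphic (η.coeffAt b) := by
  cases b
  · exact η.meromorphic
  · intro z
    by_cases hz : z = 0
    · subst hz; exact η.meromorphicAt_infty
    · have h1 : MeromorphicAt (fun w : ℂ => η.coeff w⁻¹) z :=
        (η.meromorphic z⁻¹).comp_analyticAt (analyticAt_inv hz)
      exact h1.neg.div ((MeromorphicAt.id z).pow 2)

/-- Away from `0` the factor `-1 / w ^ 2` is a unit and `w ↦ 1 / w` is a local biholomorphism, so
neither changes the order. -/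
theorem meromorphicOrderAt_coeffInfty {z : ℂ} (hz : z ≠ 0) :
    meromorphicOrderAt η.coeffInfty z = meromorphicOrderAt η.coeff z⁻¹ := by
  have h1 : meromorphicOrderAt (η.coeff ∘ fun w : ℂ => w⁻¹) z = meromorphicOrderAt η.coeff z⁻¹ :=
    meromorphicOrderAt_comp_of_deriv_ne_zero (analyticAt_inv hz) (by simp [hz])
  have h2 : AnalyticAt ℂ (fun w : ℂ => -(w ^ 2)⁻¹) z :=
    ((analyticAt_id.pow 2).inv (by simpa using hz)).neg
  have h3 : η.coeffInfty = (fun w : ℂ => -(w ^ 2)⁻¹) * (η.coeff ∘ fun w : ℂ => w⁻¹) := by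
    funext w
    simp [coeffInfty, div_eq_mul_inv, mul_comm]
  rw [h3, meromorphicOrderAt_mul h2.meromorphicAt
    ((η.meromorphic z⁻¹).comp_analyticAt (analyticAt_inv hz)), h1]
  have h4 : meromorphicOrderAt (fun w : ℂ => -(w ^ 2)⁻¹) z = 0 := by
    rw [h2.meromorphicOrderAt_eq, h2.analyticOrderAt_eq_zero.2 (by simpa using hz)]
    rfl
  rw [h4, zero_add]

theorem param_mem_poles {b : Bool} {z : ℂ} :
    param b z ∈ η.poles ↔ meromorphicOrderAt (η.coeffAt b) z < 0 := by
  have key : ∀ y : ℂ, (y : P1) ∈ η.poles ↔ meromorphicOrderAt η.coeff y < 0 := by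
    intro y
    simp only [poles, mem_ofPred_eq, OnePoint.coe_eq_coe, OnePoint.coe_ne_infty, false_and, or_false]
    exact ⟨fun ⟨y', h, h'⟩ => h ▸ h', fun h => ⟨y, rfl, h⟩⟩
  cases b
  · exact key z
  · by_cases hz : z = 0
    · subst hz
      simp [poles]
    · rw [param_true_of_ne_zero hz, key, coeffAt_true, η.meromorphicOrderAt_coeffInfty hz]

/-- `G` is a local primitive of `η` near `p`. -/
def IsPrimitiveAt (G : P1 → ℂ) (p : P1) : Prop :=
  ContMDiffAt 𝓘(ℂ, ℂ) 𝓘(ℂ, ℂ) ω G p ∧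
    ∀ᶠ q in 𝓝[≠] p, deriv (fun z : ℂ => G (z : P1)) (coord q) = η.coeff (coord q)

variable {η}

/-- A punctured neighbourhood of any point, even of `∞`, has only affine points close by, so testing
in the affine coordinate loses nothing. The chain rule for `v ↦ 1 / v` yields the coefficient in the
other chart. -/
theorem isPrimitiveAt_param {G : P1 → ℂ} {b : Bool} {z : ℂ} :
    η.IsPrimitiveAt G (param b z) ↔ AnalyticAt ℂ (fun w => G (param b w)) z ∧
      ∀ᶠ w in 𝓝[≠] z, deriv (fun w => G (param b w)) w = η.coeffAt b w := by
  rw [IsPrimitiveAt, contMDiffAt_iff_analyticAt_comp_param, eventually_nhdsNE_param]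
  refine and_congr_right fun hG => ?_
  cases b
  · rfl
  have h0 : ∀ᶠ w in 𝓝[≠] z, w ≠ 0 := by
    by_cases hz : z = 0
    · subst hz; exact self_mem_nhdsWithin
    · exact mem_nhdsWithin_of_mem_nhds (isOpen_ne.mem_nhds hz)
  have h1 : ∀ᶠ w in 𝓝[≠] z, AnalyticAt ℂ (fun w => G (param true w)) w :=
    hG.eventually_analyticAt.filter_mono nhdsWithin_le_nhds
  refine eventually_congr ?_
  filter_upwards [h0, h1] with w hw hGw
  have h2 : (fun v : ℂ => G (v : P1)) =ᶠ[𝓝 w⁻¹] (fun v => G (param true v)) ∘ fun v : ℂ => v⁻¹ := by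
    filter_upwards [isOpen_ne.mem_nhds (inv_ne_zero hw)] with v hv
    simp only [Function.comp_apply]
    rw [param_true_of_ne_zero (inv_ne_zero hv), _root_.inv_inv]
  have h3 : HasDerivAt ((fun v => G (param true v)) ∘ fun v : ℂ => v⁻¹)
      (deriv (fun w => G (param true w)) w * -((w⁻¹) ^ 2)⁻¹) w⁻¹ := by
    refine HasDerivAt.comp _ ?_ (hasDerivAt_inv (inv_ne_zero hw))
    rw [_root_.inv_inv]
    exact hGw.differentiableAt.hasDerivAt
  rw [param_true_of_ne_zero hw, coord_coe, h2.deriv_eq, h3.deriv]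
  simp only [coeffAt_true, coeffInfty]
  rw [eq_div_iff (pow_ne_zero 2 hw)]
  field_simp
  constructor <;> intro h <;> linear_combination -h

theorem IsPrimitiveAt.eventually {G : P1 → ℂ} {p : P1} (h : η.IsPrimitiveAt G p) :
    ∀ᶠ q in 𝓝 p, η.IsPrimitiveAt G q := by
  obtain ⟨b, z, -, rfl⟩ := exists_param p
  rw [isPrimitiveAt_param] at h
  rw [eventually_nhds_param]
  have h2 : ∀ᶠ w in 𝓝 z, ∀ᶠ v in 𝓝[≠] w, deriv (fun w => G (param b w)) v = η.coeffAt b v := by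
    have h3 := eventually_eventually_nhds.2 (eventually_nhdsWithin_iff.1 h.2)
    filter_upwards [h3] with w hw
    by_cases hwz : w = z
    · subst hwz; exact h.2
    · filter_upwards [hw.filter_mono nhdsWithin_le_nhds,
        mem_nhdsWithin_of_mem_nhds (isOpen_ne.mem_nhds hwz)] with v hv hv'
      exact hv hv'
  filter_upwards [h.1.eventually_analyticAt, h2] with w hw hw'
  exact isPrimitiveAt_param.2 ⟨hw, hw'⟩

theorem IsPrimitiveAt.eventually_sub_eq {G K : P1 → ℂ} {p : P1} (hG : η.IsPrimitiveAt G p)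
    (hK : η.IsPrimitiveAt K p) : ∀ᶠ q in 𝓝 p, G q - K q = G p - K p := by
  obtain ⟨b, z, -, rfl⟩ := exists_param p
  rw [isPrimitiveAt_param] at hG hK
  rw [eventually_nhds_param]
  refine (hG.1.sub hK.1).eventually_eq_of_deriv_eq_zero ?_
  filter_upwards [hG.2, hK.2, hG.1.eventually_analyticAt.filter_mono nhdsWithin_le_nhds,
    hK.1.eventually_analyticAt.filter_mono nhdsWithin_le_nhds] with w h1 h2 h3 h4
  rw [deriv_sub h3.differentiableAt h4.differentiableAt, h1, h2, sub_self]

/-- With nonnegative order, the normal form of the coefficient is holomorphic and differs from it at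
most at the centre; on a disc it has a primitive. -/
theorem exists_isPrimitiveAt {p : P1} (hp : p ∉ η.poles) : ∃ G, η.IsPrimitiveAt G p := by
  obtain ⟨b, z, -, rfl⟩ := exists_param p
  rw [param_mem_poles, not_lt] at hp
  have hm := η.meromorphic_coeffAt b z
  have ha := hm.meromorphicOrderAt_nonneg_iff_analyticAt_toMeromorphicNFAt.1 hp
  obtain ⟨r, hr, hball⟩ := Metric.eventually_nhds_iff_ball.1 ha.eventually_analyticAt
  obtain ⟨K, hK⟩ := DifferentiableOn.isExactOn_ball (c := z) (r := r)
    fun x hx => (hball x hx).differentiableAt.differentiableWithinAt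
  refine ⟨fun q => K (coordAt b q), isPrimitiveAt_param.2 ?_⟩
  simp only [coordAt_param]
  refine ⟨?_, ?_⟩
  · refine DifferentiableOn.analyticAt (s := Metric.ball z r) ?_ (Metric.ball_mem_nhds z hr)
    exact fun x hx => (hK x hx).differentiableAt.differentiableWithinAt
  · filter_upwards [hm.eq_nhdsNE_toMeromorphicNFAt,
      mem_nhdsWithin_of_mem_nhds (Metric.ball_mem_nhds z hr)] with w hw hw'
    rw [(hK w hw').deriv, hw]

end MeromorphicOneForm

/-! ### Functions of two variables that are constant on a line -/

/-- Used to extend tangency relations by continuity to the points excluded by poles, by arbitrary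
values or by a chart. -/
theorem eq_zero_of_eventually_nhdsNE_eq_zero {φ : ℂ → ℂ} {x : ℂ} (hφ : ContinuousAt φ x)
    (h : ∀ᶠ w in 𝓝[≠] x, φ w = 0) : φ x = 0 := by
  have h1 : Tendsto φ (𝓝[≠] x) (𝓝 (φ x)) := hφ.tendsto.mono_left nhdsWithin_le_nhds
  exact tendsto_nhds_unique (h1.congr' h) tendsto_const_nhds

theorem AnalyticAt.deriv_snd {L : ℂ × ℂ → ℂ} {w : ℂ × ℂ} (h : AnalyticAt ℂ L w) :
    HasDerivAt (fun y => L (w.1, y)) (fderiv ℂ L w (0, 1)) w.2 :=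
  HasFDerivAt.comp_hasDerivAt (f := fun y => (w.1, y)) w.2 h.differentiableAt.hasFDerivAt
    ((hasDerivAt_const _ _).prodMk (hasDerivAt_id _))

/-- If `L` is constant on a vertical line and has nonzero derivative transversally to it, then its
fibre is locally this line. -/
theorem AnalyticAt.eventually_fst_eq {L : ℂ × ℂ → ℂ} {a b : ℂ} (hL : AnalyticAt ℂ L (a, b))
    (h : ∀ᶠ y in 𝓝 b, fderiv ℂ L (a, y) (0, 1) = 0) (hne : fderiv ℂ L (a, b) (1, 0) ≠ 0) :
    ∀ᶠ w in 𝓝 (a, b), L w = L (a, b) → w.1 = a := by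
  have hcont : Continuous fun y : ℂ => (a, y) := by fun_prop
  have h1 : ∀ᶠ y in 𝓝 b, L (a, y) = L (a, b) := by
    have ha : AnalyticAt ℂ (fun y => L (a, y)) b :=
      AnalyticAt.comp (f := fun y => (a, y)) hL (analyticAt_const.prod analyticAt_id)
    refine ha.eventually_eq_of_deriv_eq_zero (Eventually.filter_mono nhdsWithin_le_nhds ?_)
    filter_upwards [h, hcont.continuousAt.eventually hL.eventually_analyticAt] with y hy hy'
    exact hy'.deriv_snd.deriv.trans hy
  -- Strict differentiability compares `w` with its projection `(a, w.2)` to the line: `L w - L (a,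
  -- w.2)` is `(w.1 - a) ∂₁L` up to half its size, so it vanishes only on the line.
  have h2 := hL.hasStrictFDerivAt.isLittleO
  have hc : 0 < ‖fderiv ℂ L (a, b) (1, 0)‖ / 2 := half_pos (norm_pos_iff.2 hne)
  have h3 : Tendsto (fun w : ℂ × ℂ => (w, (a, w.2))) (𝓝 (a, b)) (𝓝 ((a, b), (a, b))) := by
    have : Continuous fun w : ℂ × ℂ => (w, (a, w.2)) := by fun_prop
    exact this.tendsto (a, b)
  filter_upwards [h3.eventually (h2.def hc), continuous_snd.continuousAt.eventually h1]
    with w hw hw1 hLw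
  have e1 : w - (a, w.2) = (w.1 - a) • ((1 : ℂ), (0 : ℂ)) := by
    ext <;> simp
  simp only [hLw, hw1, e1, sub_self, zero_sub, map_smul, norm_neg, norm_smul] at hw
  by_contra hne'
  have h5 : 0 < ‖w.1 - a‖ := norm_pos_iff.2 (sub_ne_zero.2 hne')
  have h6 : ‖((1 : ℂ), (0 : ℂ))‖ = 1 := by simp [Prod.norm_def]
  rw [h6] at hw
  nlinarith

/-! ### Local first integrals in coordinates -/

namespace P1

/-- The change from the coordinate `P1.coordAt b` to the affine coordinate. -/
noncomputable def toAffine (b : Bool) (z : ℂ) : ℂ := bif b then z⁻¹ else z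

/-- The derivative of the inverse of `P1.toAffine b`, in terms of `P1.coordAt b`. -/
noncomputable def fromAffineDeriv (b : Bool) (z : ℂ) : ℂ := bif b then -z ^ 2 else 1

/-- The recurring condition `b = true → z ≠ 0` says that `param b z` is an affine point. -/
theorem param_eq_coe {b : Bool} {z : ℂ} (hz : b = true → z ≠ 0) :
    param b z = ((toAffine b z : ℂ) : P1) := by
  cases b
  · rfl
  · exact param_true_of_ne_zero (hz rfl)

theorem toAffine_toAffine (b : Bool) (z : ℂ) : toAffine b (toAffine b z) = z := by
  cases b <;> simp [toAffine]

theorem toAffine_ne_zero {b : Bool} {z : ℂ} (hz : b = true → z ≠ 0) :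
    b = true → toAffine b z ≠ 0 := by
  rintro rfl
  simpa [toAffine] using hz rfl

theorem hasDerivAt_toAffine {b : Bool} {z : ℂ} (hz : b = true → z ≠ 0) :
    HasDerivAt (toAffine b) (fromAffineDeriv b z) (toAffine b z) := by
  cases b
  · exact hasDerivAt_id z
  · have := hasDerivAt_inv (inv_ne_zero (hz rfl))
    simp only [_root_.inv_pow, _root_.inv_inv] at this
    exact this

theorem analyticAt_toAffine {b : Bool} {z : ℂ} (hz : b = true → z ≠ 0) :
    AnalyticAt ℂ (toAffine b) z := by
  cases b
  · exact analyticAt_id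
  · exact analyticAt_inv (hz rfl)

theorem fromAffineDeriv_ne_zero {b : Bool} {z : ℂ} (hz : b = true → z ≠ 0) :
    fromAffineDeriv b z ≠ 0 := by
  cases b
  · simp [fromAffineDeriv]
  · simpa [fromAffineDeriv] using hz rfl

theorem eventually_valid (b : Bool) (z : ℂ) : ∀ᶠ w in 𝓝[≠] z, b = true → w ≠ 0 := by
  by_cases hz : z = 0
  · subst hz
    filter_upwards [self_mem_nhdsWithin] with w hw _ using hw
  · filter_upwards [mem_nhdsWithin_of_mem_nhds (isOpen_ne.mem_nhds hz)] with w hw _ using hw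

end P1

namespace MeromorphicOneForm

variable (η : MeromorphicOneForm)

/-- The transformation law of the coefficient of a 1-form under change of coordinate. -/
theorem coeffAt_mul_fromAffineDeriv {b : Bool} {z : ℂ} (hz : b = true → z ≠ 0) :
    η.coeffAt b z * fromAffineDeriv b z = η.coeff (toAffine b z) := by
  cases b
  · simp [fromAffineDeriv, toAffine]
  · have := hz rfl
    simp only [coeffAt_true, coeffInfty, fromAffineDeriv, toAffine, cond_true]
    field_simp

/-- Tangency of a local first integral is only required where the affine coefficient is analytic;
this makes it available off the centre of either chart. -/
theorem eventually_analyticAt_coeff (b : Bool) (z : ℂ) :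
    ∀ᶠ w in 𝓝[≠] z, AnalyticAt ℂ η.coeff (toAffine b w) := by
  filter_upwards [(η.meromorphic_coeffAt b z).eventually_analyticAt, eventually_valid b z]
    with w hw hw0
  have hv := toAffine_ne_zero hw0
  have h1 : AnalyticAt ℂ (fun v => η.coeffAt b (toAffine b v) * fromAffineDeriv b (toAffine b v))
      (toAffine b w) := by
    have h2 : AnalyticAt ℂ (fromAffineDeriv b) w := by
      cases b
      · exact analyticAt_const
      · exact (analyticAt_id.pow 2).neg
    have h3 := analyticAt_toAffine hv
    rw [← toAffine_toAffine b w] at hw h2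
    exact (hw.comp h3).mul (h2.comp h3)
  refine h1.congr ?_
  have h4 : ∀ᶠ v in 𝓝 (toAffine b w), b = true → v ≠ 0 := by
    by_cases hb : b = true
    · filter_upwards [isOpen_ne.mem_nhds (hv hb)] with v hv' _ using hv'
    · exact Eventually.of_forall fun v h => absurd h hb
  filter_upwards [h4] with v hv'
  rw [η.coeffAt_mul_fromAffineDeriv (toAffine_ne_zero hv'), toAffine_toAffine]

end MeromorphicOneForm

namespace IsLocalFirstIntegral

variable {η : MeromorphicOneForm} {f : P1 × P1 → ℂ} {a b : Bool} {x y : ℂ}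

/-- A function on `P1 × P1` in coordinates. -/
noncomputable def _root_.P1.chartRep (f : P1 × P1 → ℂ) (a b : Bool) (w : ℂ × ℂ) : ℂ :=
  f (param a w.1, param b w.2)

theorem analyticAt_chartRep (hf : IsLocalFirstIntegral η (param a x, param b y) f) :
    AnalyticAt ℂ (chartRep f a b) (x, y) := by
  refine ContDiffAt.analyticAt (ContMDiffAt.contDiffAt (n := ω) ?_)
  have h1 : ContMDiffAt 𝓘(ℂ, ℂ × ℂ) (𝓘(ℂ, ℂ).prod 𝓘(ℂ, ℂ)) ω
      (fun w : ℂ × ℂ => (param a w.1, param b w.2)) (x, y) :=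
    ContMDiffAt.prodMk
      ((contMDiff_param a).contMDiffAt.comp (x, y) contDiff_fst.contMDiff.contMDiffAt)
      ((contMDiff_param b).contMDiffAt.comp (x, y) contDiff_snd.contMDiff.contMDiffAt)
  exact ContMDiffAt.comp (g := f) (x, y) hf.1 h1

theorem fderiv_chartRep_ne_zero (hf : IsLocalFirstIntegral η (param a x, param b y) f) :
    fderiv ℂ (chartRep f a b) (x, y) ≠ 0 := by
  intro h0
  refine hf.2.1 ?_
  have hc : MDifferentiableAt (𝓘(ℂ, ℂ).prod 𝓘(ℂ, ℂ)) 𝓘(ℂ, ℂ × ℂ)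
      (fun q : P1 × P1 => (coordAt a q.1, coordAt b q.2)) (param a x, param b y) := by
    refine MDifferentiableAt.prodMk_space ?_ ?_
    · exact MDifferentiableAt.comp (g := coordAt a) (param a x, param b y)
        ((contMDiffAt_coordAt a x).mdifferentiableAt (by simp)) mdifferentiableAt_fst
    · exact MDifferentiableAt.comp (g := coordAt b) (param a x, param b y)
        ((contMDiffAt_coordAt b y).mdifferentiableAt (by simp)) mdifferentiableAt_snd
  have he : f =ᶠ[𝓝 (param a x, param b y)]
      chartRep f a b ∘ fun q : P1 × P1 => (coordAt a q.1, coordAt b q.2) := by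
    filter_upwards [(param_coordAt_eventually a x).prod_nhds (param_coordAt_eventually b y)]
      with q hq
    simp only [Function.comp_apply, chartRep, hq.1, hq.2]
  have hp : (coordAt a (param a x), coordAt b (param b y)) = (x, y) := by simp
  have hd : MDifferentiableAt 𝓘(ℂ, ℂ × ℂ) 𝓘(ℂ, ℂ) (chartRep f a b)
      (coordAt a (param a x), coordAt b (param b y)) := by
    rw [hp]
    exact hf.analyticAt_chartRep.differentiableAt.mdifferentiableAt
  have hz : mfderiv 𝓘(ℂ, ℂ × ℂ) 𝓘(ℂ, ℂ) (chartRep f a b)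
      (coordAt a (param a x), coordAt b (param b y)) = 0 := by
    rw [mfderiv_eq_fderiv, hp]
    exact h0
  refine he.mfderiv_eq.trans ((mfderiv_comp
    (f := fun q : P1 × P1 => (coordAt a q.1, coordAt b q.2)) (param a x, param b y) hd hc).trans ?_)
  exact (congrArg (fun l : ℂ × ℂ →L[ℂ] ℂ => l.comp _) hz).trans (ContinuousLinearMap.zero_comp _)

/-- In charts the kernel of `dx - η` is spanned by this vector: for `u = 1 / x`, the relation `dx =
η` becomes `du = -u ^ 2 η`. -/
theorem eventually_fderiv_chartRep (hf : IsLocalFirstIntegral η (param a x, param b y) f) :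
    ∀ᶠ w in 𝓝 (x, y), (a = true → w.1 ≠ 0) → w.2 ≠ y →
      fderiv ℂ (chartRep f a b) w (fromAffineDeriv a w.1 * η.coeffAt b w.2, 1) = 0 := by
  have h1 := (((continuous_param a).prodMap (continuous_param b)).tendsto (x, y)).eventually hf.2.2
  have h2 : ∀ᶠ w : ℂ × ℂ in 𝓝 (x, y), w.2 ≠ y →
      AnalyticAt ℂ η.coeff (toAffine b w.2) ∧ (b = true → w.2 ≠ 0) :=
    (continuous_snd.tendsto (x, y)).eventually (eventually_nhdsWithin_iff.1
      ((η.eventually_analyticAt_coeff b y).and (eventually_valid b y)))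
  filter_upwards [h1, h2, hf.analyticAt_chartRep.eventually_analyticAt] with w hw1 hw2 hw3 ha hy
  obtain ⟨hw2, hb⟩ := hw2 hy
  set X := toAffine a w.1 with hX
  set Y := toAffine b w.2 with hY
  have hA : HasFDerivAt (fun z : ℂ × ℂ => (toAffine a z.1, toAffine b z.2))
      (((fromAffineDeriv a w.1) • ContinuousLinearMap.fst ℂ ℂ ℂ).prod
        ((fromAffineDeriv b w.2) • ContinuousLinearMap.snd ℂ ℂ ℂ)) (X, Y) := by
    refine HasFDerivAt.prodMk ?_ ?_
    · exact HasDerivAt.comp_hasFDerivAt (f := Prod.fst) (X, Y) (hasDerivAt_toAffine ha) hasFDerivAt_fst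
    · exact HasDerivAt.comp_hasFDerivAt (f := Prod.snd) (X, Y) (hasDerivAt_toAffine hb) hasFDerivAt_snd
  have hF : HasFDerivAt (chartRep f a b) (fderiv ℂ (chartRep f a b) w)
      (toAffine a X, toAffine b Y) := by
    rw [hX, hY, toAffine_toAffine, toAffine_toAffine]
    exact hw3.differentiableAt.hasFDerivAt
  have hcomp := HasFDerivAt.comp (f := fun z : ℂ × ℂ => (toAffine a z.1, toAffine b z.2)) (X, Y)
    hF hA
  have hev : (fun z : ℂ × ℂ => f ((z.1 : P1), (z.2 : P1))) =ᶠ[𝓝 (X, Y)]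
      chartRep f a b ∘ fun z : ℂ × ℂ => (toAffine a z.1, toAffine b z.2) := by
    have hval : ∀ (c : Bool) (v : ℂ), (c = true → v ≠ 0) →
        ∀ᶠ u in 𝓝 (toAffine c v), param c (toAffine c u) = (u : P1) := by
      intro c v hv
      have h4 : ∀ᶠ u in 𝓝 (toAffine c v), c = true → u ≠ 0 := by
        by_cases hc : c = true
        · filter_upwards [isOpen_ne.mem_nhds (toAffine_ne_zero hv hc)] with v hv' _ using hv'
        · exact Eventually.of_forall fun v h => absurd h hc
      filter_upwards [h4] with u hu
      rw [param_eq_coe (toAffine_ne_zero hu), toAffine_toAffine]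
    filter_upwards [(hval a w.1 ha).prod_nhds (hval b w.2 hb)] with z hz
    simp only [Function.comp_apply, chartRep, hz.1, hz.2]
  have hlam := fromAffineDeriv_ne_zero hb
  -- The affine tangent vector is scaled so that its second component in the chart is `1`.
  have key := hw1 X Y (by simp [Prod.map, hX, hY, param_eq_coe ha, param_eq_coe hb]) hw2
    (η.coeff Y * (fromAffineDeriv b w.2)⁻¹, (fromAffineDeriv b w.2)⁻¹) (by simp)
  rw [hev.fderiv_eq, hcomp.fderiv] at key
  simp only [ContinuousLinearMap.comp_apply, ContinuousLinearMap.prod_apply,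
    smul_apply, ContinuousLinearMap.coe_fst', ContinuousLinearMap.coe_snd',
    smul_eq_mul, mul_inv_cancel₀ hlam] at key
  rw [hY, ← η.coeffAt_mul_fromAffineDeriv hb, mul_inv_cancel_right₀ hlam] at key
  exact key

end IsLocalFirstIntegral

/-! ### Fibres of local first integrals -/

theorem AnalyticAt.eventually_snd_eq {L : ℂ × ℂ → ℂ} {a b : ℂ} (hL : AnalyticAt ℂ L (a, b))
    (h : ∀ᶠ x in 𝓝 a, fderiv ℂ L (x, b) (1, 0) = 0) (hne : fderiv ℂ L (a, b) (0, 1) ≠ 0) :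
    ∀ᶠ w in 𝓝 (a, b), L w = L (a, b) → w.2 = b := by
  have hs : ∀ w v : ℂ × ℂ, AnalyticAt ℂ L w →
      fderiv ℂ (L ∘ Prod.swap) w.swap v = fderiv ℂ L w v.swap := by
    intro w v hw
    have h1 : HasFDerivAt (Prod.swap : ℂ × ℂ → ℂ × ℂ)
        (ContinuousLinearEquiv.prodComm ℂ ℂ ℂ : ℂ × ℂ →L[ℂ] ℂ × ℂ) w.swap :=
      (ContinuousLinearEquiv.prodComm ℂ ℂ ℂ : ℂ × ℂ →L[ℂ] ℂ × ℂ).hasFDerivAt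
    have h2 : HasFDerivAt L (fderiv ℂ L w) (Prod.swap w.swap) := by
      rw [Prod.swap_swap]; exact hw.differentiableAt.hasFDerivAt
    rw [(h2.comp _ h1).fderiv]
    rfl
  have hcont : Continuous fun x : ℂ => (x, b) := by fun_prop
  have hL' : AnalyticAt ℂ (L ∘ Prod.swap) (b, a) :=
    AnalyticAt.comp (f := Prod.swap) (x := (b, a)) hL (analyticAt_snd.prod analyticAt_fst)
  have key := hL'.eventually_fst_eq ?_ ?_
  · filter_upwards [(continuous_swap.tendsto (a, b)).eventually key] with w hw hLw
    exact hw (by simpa using hLw)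
  · filter_upwards [h, (hcont.tendsto a).eventually hL.eventually_analyticAt] with x hx hx'
    exact (hs (x, b) (0, 1) hx').trans hx
  · have := hs (a, b) (1, 0) hL
    simp only [Prod.swap_prod_mk] at this
    rwa [this]

theorem ContinuousLinearMap.eq_zero_of_basis {A : ℂ × ℂ →L[ℂ] ℂ} (h1 : A (1, 0) = 0)
    (h2 : A (0, 1) = 0) : A = 0 := by
  ext <;> simpa

theorem ContinuousLinearMap.apply_pair (A : ℂ × ℂ →L[ℂ] ℂ) (u v : ℂ) :
    A (u, v) = u * A (1, 0) + v * A (0, 1) := by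
  have : ((u, v) : ℂ × ℂ) = u • ((1 : ℂ), (0 : ℂ)) + v • ((0 : ℂ), (1 : ℂ)) := by ext <;> simp
  rw [this, map_add, map_smul, map_smul, smul_eq_mul, smul_eq_mul]

theorem P1.eventually_nhds_param_prod {a b : Bool} {x y : ℂ} {P : P1 × P1 → Prop} :
    (∀ᶠ q in 𝓝 (param a x, param b y), P q) ↔ ∀ᶠ w in 𝓝 (x, y), P (param a w.1, param b w.2) := by
  rw [nhds_prod_eq, nhds_param, nhds_param, prod_map_map_eq, eventually_map, nhds_prod_eq]

theorem AnalyticAt.continuousAt_fderiv_apply {L : ℂ × ℂ → ℂ} {c u v : ℂ → ℂ} {d : ℂ → ℂ} {t : ℂ}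
    (hL : AnalyticAt ℂ L (c t, d t)) (hc : ContinuousAt c t) (hd : ContinuousAt d t)
    (hu : ContinuousAt u t) (hv : ContinuousAt v t) :
    ContinuousAt (fun s => fderiv ℂ L (c s, d s) (u s, v s)) t := by
  have h1 : ContinuousAt (fun s => (c s, d s)) t := hc.prodMk hd
  have h2 : ContinuousAt (fun s => fderiv ℂ L (c s, d s)) t :=
    ContinuousAt.comp (f := fun s => (c s, d s)) (g := fderiv ℂ L) hL.fderiv.continuousAt h1
  exact h2.clm_apply (hu.prodMk hv)

namespace IsLocalFirstIntegral

variable {η : MeromorphicOneForm} {f : P1 × P1 → ℂ} {a b : Bool} {x y : ℂ}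

/-- The first component of the tangent field, `-u ^ 2` times the coefficient, vanishes at `u = 0`.
Letting `u → 0` for fixed `y' ≠ y` and then `y' → y` gives the claim. -/
theorem eventually_fderiv_infty (hf : IsLocalFirstIntegral η (param true 0, param b y) f) :
    ∀ᶠ y' in 𝓝 y, fderiv ℂ (chartRep f true b) (0, y') (0, 1) = 0 := by
  have h1 := hf.eventually_fderiv_chartRep.and hf.analyticAt_chartRep.eventually_analyticAt
  have h2 := ((continuous_swap.tendsto (y, (0 : ℂ))).eventually h1).curry_nhds
  have h3 : ∀ᶠ y' in 𝓝 y, y' ≠ y → fderiv ℂ (chartRep f true b) (0, y') (0, 1) = 0 := by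
    filter_upwards [h2] with y' hy' hne
    have hc : ContinuousAt (fun x' => fderiv ℂ (chartRep f true b) (x', y')
        (fromAffineDeriv true x' * η.coeffAt b y', 1)) 0 := by
      refine AnalyticAt.continuousAt_fderiv_apply (d := fun _ => y') hy'.self_of_nhds.2
        continuousAt_id continuousAt_const ?_ continuousAt_const
      have : Continuous fun x' => fromAffineDeriv true x' * η.coeffAt b y' := by
        simp only [fromAffineDeriv, cond_true]; fun_prop
      exact this.continuousAt
    have := eq_zero_of_eventually_nhdsNE_eq_zero hc (eventually_nhdsWithin_iff.2 (by
      filter_upwards [hy'] with x' hx' hx0 using hx'.1 (fun _ => hx0) hne))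
    simpa [fromAffineDeriv] using this
  filter_upwards [h3] with y' hy'
  by_cases hne : y' = y
  · subst hne
    exact eq_zero_of_eventually_nhdsNE_eq_zero
      (AnalyticAt.continuousAt_fderiv_apply (c := fun _ => 0) hf.analyticAt_chartRep
        continuousAt_const continuousAt_id continuousAt_const continuousAt_const)
      (eventually_nhdsWithin_iff.2 h3)
  · exact hy' hne

/-- The fibre `{∞} × P1` is invariant by the foliation. -/
theorem eventually_fst_eq_infty {Y : P1} (hf : IsLocalFirstIntegral η (OnePoint.infty, Y) f) :
    ∀ᶠ q in 𝓝 ((OnePoint.infty : P1), Y), f q = f (OnePoint.infty, Y) → q.1 = OnePoint.infty := by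
  obtain ⟨b, y, -, rfl⟩ := exists_param Y
  have h0 : (OnePoint.infty : P1) = param true 0 := by simp
  rw [h0] at hf ⊢
  rw [eventually_nhds_param_prod]
  have h1 := hf.eventually_fderiv_infty
  filter_upwards [hf.analyticAt_chartRep.eventually_fst_eq h1 fun h =>
    hf.fderiv_chartRep_ne_zero (ContinuousLinearMap.eq_zero_of_basis h h1.self_of_nhds)]
    with w hw hfw
  rw [hw hfw]

/-- The line `P1 × {Y}` over a pole `Y` of `η` is invariant by the foliation. -/
theorem eventually_snd_eq_of_mem_poles {X Y : P1} (hf : IsLocalFirstIntegral η (X, Y) f)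
    (hY : Y ∈ η.poles) : ∀ᶠ q in 𝓝 (X, Y), f q = f (X, Y) → q.2 = Y := by
  obtain ⟨a, x, -, rfl⟩ := exists_param X
  obtain ⟨b, y, -, rfl⟩ := exists_param Y
  rw [η.param_mem_poles] at hY
  have hg := tendsto_inv₀_cobounded.comp (tendsto_cobounded_of_meromorphicOrderAt_neg hY)
  rw [eventually_nhds_param_prod]
  have h1 := (hf.eventually_fderiv_chartRep.and
    hf.analyticAt_chartRep.eventually_analyticAt).curry_nhds
  -- Dividing the tangency relation by the coefficient, whose inverse tends to `0` at the pole,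
  -- leaves only the derivative along the line in the limit.
  have h2 : ∀ᶠ x' in 𝓝 x, (a = true → x' ≠ 0) → fderiv ℂ (chartRep f a b) (x', y) (1, 0) = 0 := by
    filter_upwards [h1] with x' hx' hne
    have hlam := fromAffineDeriv_ne_zero hne
    have han := hx'.self_of_nhds.2
    have t1 : Tendsto (fun y' => fderiv ℂ (chartRep f a b) (x', y') (1, 0)) (𝓝[≠] y)
        (𝓝 (fderiv ℂ (chartRep f a b) (x', y) (1, 0))) :=
      (AnalyticAt.continuousAt_fderiv_apply (c := fun _ => x') han continuousAt_const
        continuousAt_id continuousAt_const continuousAt_const).tendsto.mono_left nhdsWithin_le_nhds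
    have t2 : Tendsto (fun y' => fderiv ℂ (chartRep f a b) (x', y') (0, 1)) (𝓝[≠] y)
        (𝓝 (fderiv ℂ (chartRep f a b) (x', y) (0, 1))) :=
      (AnalyticAt.continuousAt_fderiv_apply (c := fun _ => x') han continuousAt_const
        continuousAt_id continuousAt_const continuousAt_const).tendsto.mono_left nhdsWithin_le_nhds
    have t3 := ((t2.mul hg).const_mul (-(fromAffineDeriv a x')⁻¹))
    rw [mul_zero, mul_zero] at t3
    refine tendsto_nhds_unique (t1.congr' ?_) t3
    have hg0 : ∀ᶠ y' in 𝓝[≠] y, η.coeffAt b y' ≠ 0 :=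
      (tendsto_cobounded_of_meromorphicOrderAt_neg hY).eventually
        (Bornology.eventually_ne_cobounded 0)
    filter_upwards [mem_nhdsWithin_of_mem_nhds hx', self_mem_nhdsWithin, hg0] with y' h3 h4 h5
    have h6 := h3.1 hne h4
    rw [ContinuousLinearMap.apply_pair] at h6
    simp only [Function.comp_apply]
    field_simp
    linear_combination h6
  have h3 : ∀ᶠ x' in 𝓝 x, fderiv ℂ (chartRep f a b) (x', y) (1, 0) = 0 := by
    filter_upwards [h2.eventually_nhds, h1] with x' hx' hx2
    by_cases hv : a = true → x' ≠ 0
    · exact hx'.self_of_nhds hv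
    · exact eq_zero_of_eventually_nhdsNE_eq_zero
        (AnalyticAt.continuousAt_fderiv_apply (d := fun _ => y) hx2.self_of_nhds.2
          continuousAt_id continuousAt_const continuousAt_const continuousAt_const)
        (by filter_upwards [mem_nhdsWithin_of_mem_nhds hx', eventually_valid a x'] with v h4 h5
              using h4 h5)
  filter_upwards [hf.analyticAt_chartRep.eventually_snd_eq h3 fun h =>
    hf.fderiv_chartRep_ne_zero (ContinuousLinearMap.eq_zero_of_basis h3.self_of_nhds h)]
    with w hw hfw
  rw [hw hfw]

/-- Replacing the coefficient by the derivative of an analytic primitive makes the tangent field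
continuous, so tangency extends across the excluded line. -/
theorem eventually_fderiv_primitive (hf : IsLocalFirstIntegral η (param false x, param b y) f)
    {G : P1 → ℂ} (hG : η.IsPrimitiveAt G (param b y)) :
    ∀ᶠ w in 𝓝 (x, y), fderiv ℂ (chartRep f false b) w
      (deriv (fun v => G (param b v)) w.2, 1) = 0 := by
  rw [MeromorphicOneForm.isPrimitiveAt_param] at hG
  have hg := (eventually_nhdsWithin_iff.1 hG.2).and hG.1.eventually_analyticAt
  have h1 := (hf.eventually_fderiv_chartRep.and
    hf.analyticAt_chartRep.eventually_analyticAt).and ((continuous_snd.tendsto (x, y)).eventually hg)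
  filter_upwards [h1.eventually_nhds] with w hw
  obtain ⟨w1, w2⟩ := w
  have h2 : ∀ᶠ y' in 𝓝 w2, y' ≠ y → fderiv ℂ (chartRep f false b) (w1, y')
      (deriv (fun v => G (param b v)) y', 1) = 0 := by
    filter_upwards [hw.curry_nhds.self_of_nhds] with y' h3 hy'
    rw [h3.2.1 hy']
    have := h3.1.1 (by simp) hy'
    simpa [fromAffineDeriv] using this
  have h0 := hw.self_of_nhds
  refine eq_zero_of_eventually_nhdsNE_eq_zero
    (φ := fun y' => fderiv ℂ (chartRep f false b) (w1, y') (deriv (fun v => G (param b v)) y', 1))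
    (AnalyticAt.continuousAt_fderiv_apply (c := fun _ => w1) h0.1.2 continuousAt_const
      continuousAt_id h0.2.2.deriv.continuousAt continuousAt_const) ?_
  by_cases hy : w2 = y
  · subst hy
    exact eventually_nhdsWithin_iff.2 h2
  · filter_upwards [mem_nhdsWithin_of_mem_nhds h2,
      mem_nhdsWithin_of_mem_nhds (isOpen_ne.mem_nhds hy)] with v hv hv' using hv hv'

/-- Over the regular points of `η`, the plaques of the foliation are contained in the fibres of
`x - G(y)`, where `G` is a primitive of `η`. -/
theorem eventually_sub_primitive_eq {X Y : P1} (hf : IsLocalFirstIntegral η (X, Y) f)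
    (hX : X ≠ OnePoint.infty) {G : P1 → ℂ} (hG : η.IsPrimitiveAt G Y) :
    ∀ᶠ q in 𝓝 (X, Y), f q = f (X, Y) → coord q.1 - G q.2 = coord X - G Y := by
  obtain ⟨x, rfl⟩ := OnePoint.ne_infty_iff_exists.1 hX
  obtain ⟨b, y, -, rfl⟩ := exists_param Y
  change IsLocalFirstIntegral η (param false x, param b y) f at hf
  change ∀ᶠ q in 𝓝 (param false x, param b y), _
  rw [eventually_nhds_param_prod]
  have hd := hf.eventually_fderiv_primitive hG
  have hG1 := (MeromorphicOneForm.isPrimitiveAt_param.1 hG).1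
  set g : ℂ → ℂ := fun v => G (param b v) with hgdef
  have hgc : Continuous fun w : ℂ × ℂ => w.1 - w.2 := by fun_prop
  -- The inverse of `(x, y) ↦ (x - G(y), y)`, which straightens the leaves to vertical lines so that
  -- `eventually_fst_eq` applies.
  set Ψ : ℂ × ℂ → ℂ × ℂ := fun w => (w.1 + g w.2, w.2) with hΨ
  have hg2 : AnalyticAt ℂ (fun w : ℂ × ℂ => g w.2) (x - g y, y) :=
    AnalyticAt.comp (f := Prod.snd) (x := (x - g y, y)) hG1 analyticAt_snd
  have hΨa : AnalyticAt ℂ Ψ (x - g y, y) := (analyticAt_fst.add hg2).prod analyticAt_snd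
  have hΨ0 : Ψ (x - g y, y) = (x, y) := by simp [hΨ]
  have hLa : AnalyticAt ℂ (chartRep f false b ∘ Ψ) (x - g y, y) :=
    AnalyticAt.comp (by rw [hΨ0]; exact hf.analyticAt_chartRep) hΨa
  have hder : ∀ w : ℂ × ℂ, AnalyticAt ℂ g w.2 → AnalyticAt ℂ (chartRep f false b) (Ψ w) →
      ∀ v : ℂ × ℂ, fderiv ℂ (chartRep f false b ∘ Ψ) w v =
        fderiv ℂ (chartRep f false b) (Ψ w) (v.1 + deriv g w.2 * v.2, v.2) := by
    intro w h1 h2 v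
    have h3 : HasFDerivAt (fun w : ℂ × ℂ => g w.2) (deriv g w.2 • ContinuousLinearMap.snd ℂ ℂ ℂ) w :=
      HasDerivAt.comp_hasFDerivAt (f := Prod.snd) w h1.differentiableAt.hasDerivAt hasFDerivAt_snd
    have h4 : HasFDerivAt Ψ _ w := ((hasFDerivAt_fst (𝕜 := ℂ)).add h3).prodMk hasFDerivAt_snd
    rw [(h2.differentiableAt.hasFDerivAt.comp w h4).fderiv]
    simp
  have e1 : ∀ᶠ y' in 𝓝 y, fderiv ℂ (chartRep f false b ∘ Ψ) (x - g y, y') (0, 1) = 0 := by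
    have hc : ContinuousAt (fun y' => Ψ (x - g y, y')) y :=
      ContinuousAt.comp (f := fun y' => (x - g y, y')) (g := Ψ) hΨa.continuousAt
        (by fun_prop)
    have hc' := hc.tendsto
    simp only [hΨ0] at hc'
    filter_upwards [hc'.eventually (hd.and hf.analyticAt_chartRep.eventually_analyticAt),
      hG1.eventually_analyticAt] with y' h1 h2
    rw [hder _ h2 h1.2]
    simpa using h1.1
  have e2 : fderiv ℂ (chartRep f false b ∘ Ψ) (x - g y, y) (1, 0) ≠ 0 := by
    rw [hder _ hG1 (by rw [hΨ0]; exact hf.analyticAt_chartRep), hΨ0]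
    simp only [mul_zero, add_zero]
    intro h
    refine hf.fderiv_chartRep_ne_zero (ContinuousLinearMap.eq_zero_of_basis h ?_)
    have := hd.self_of_nhds
    rw [ContinuousLinearMap.apply_pair, h] at this
    simpa using this
  have key := hLa.eventually_fst_eq e1 e2
  have hΦ : ContinuousAt (fun w : ℂ × ℂ => (w.1 - g w.2, w.2)) (x, y) := by
    have : ContinuousAt (fun w : ℂ × ℂ => g w.2) (x, y) :=
      ContinuousAt.comp (f := Prod.snd) (x := (x, y)) hG1.continuousAt continuousAt_snd
    exact (continuousAt_fst.sub this).prodMk continuousAt_snd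
  filter_upwards [hΦ.eventually key] with w hw hfw
  refine hw ?_
  simp only [Function.comp_apply, hΨ, sub_add_cancel]
  exact hfw

end IsLocalFirstIntegral

/-! ### Transversality to the fibres of `dx = 0` -/

theorem P1.mfderiv_param_eq_zero_iff {g : P1 → ℂ} {b : Bool} {y : ℂ}
    (hg : ContMDiffAt 𝓘(ℂ, ℂ) 𝓘(ℂ, ℂ) ω g (param b y)) :
    mfderiv 𝓘(ℂ, ℂ) 𝓘(ℂ, ℂ) g (param b y) = 0 ↔ deriv (fun w => g (param b w)) y = 0 := by
  have ha := contMDiffAt_iff_analyticAt_comp_param.1 hg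
  have hgd : MDifferentiableAt 𝓘(ℂ, ℂ) 𝓘(ℂ, ℂ) g (param b y) := hg.mdifferentiableAt (by simp)
  have hpd : MDifferentiableAt 𝓘(ℂ, ℂ) 𝓘(ℂ, ℂ) (param b) y :=
    (contMDiff_param b).contMDiffAt.mdifferentiableAt (by simp)
  have hcd : MDifferentiableAt 𝓘(ℂ, ℂ) 𝓘(ℂ, ℂ) (coordAt b) (param b y) :=
    (contMDiffAt_coordAt b y).mdifferentiableAt (by simp)
  constructor
  · intro h
    have h1 := mfderiv_comp y hgd hpd
    have h2 : mfderiv 𝓘(ℂ, ℂ) 𝓘(ℂ, ℂ) (g ∘ param b) y = 0 := h1.trans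
      ((congrArg (fun l : ℂ →L[ℂ] ℂ => l.comp _) h).trans (ContinuousLinearMap.zero_comp _))
    rw [mfderiv_eq_fderiv] at h2
    have h3 : deriv (g ∘ param b) y = fderiv ℂ (g ∘ param b) y 1 := rfl
    exact h3.trans (congrArg (fun l : ℂ →L[ℂ] ℂ => l 1) h2)
  · intro h
    have he : g =ᶠ[𝓝 (param b y)] (fun w => g (param b w)) ∘ coordAt b := by
      filter_upwards [param_coordAt_eventually b y] with q hq
      simp only [Function.comp_apply, hq]
    have hd : MDifferentiableAt 𝓘(ℂ, ℂ) 𝓘(ℂ, ℂ) (fun w => g (param b w)) (coordAt b (param b y)) := by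
      rw [coordAt_param]
      exact ha.differentiableAt.mdifferentiableAt
    have hz : mfderiv 𝓘(ℂ, ℂ) 𝓘(ℂ, ℂ) (fun w => g (param b w)) (coordAt b (param b y)) = 0 := by
      rw [mfderiv_eq_fderiv, coordAt_param]
      have h4 := ha.differentiableAt.hasDerivAt.hasFDerivAt.fderiv
      rw [h] at h4
      exact h4.trans (ContinuousLinearMap.toSpanSingleton_zero ℂ)
    refine he.mfderiv_eq.trans ((mfderiv_comp (param b y) hd hcd).trans ?_)
    exact (congrArg (fun l : ℂ →L[ℂ] ℂ => l.comp _) hz).trans (ContinuousLinearMap.zero_comp _)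

section

variable {η : MeromorphicOneForm}

theorem MeromorphicOneForm.IsPrimitiveAt.deriv_coe_eq {G : P1 → ℂ} {y : ℂ}
    (hG : η.IsPrimitiveAt G (y : P1)) (hy : AnalyticAt ℂ η.coeff y) :
    deriv (fun z : ℂ => G (z : P1)) y = η.coeff y := by
  have h := (MeromorphicOneForm.isPrimitiveAt_param (b := false)).1 hG
  have h1 := h.1.deriv.continuousAt.sub hy.continuousAt
  refine sub_eq_zero.1 (eq_zero_of_eventually_nhdsNE_eq_zero (x := y) h1 ?_)
  filter_upwards [h.2] with w hw
  exact sub_eq_zero.2 hw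

/-- A primitive `G` of `η` yields the local first integral `x - G(y)`. -/
theorem MeromorphicOneForm.IsPrimitiveAt.isLocalFirstIntegral {G : P1 → ℂ} {Y : P1}
    (hG : η.IsPrimitiveAt G Y) {X : P1} (hX : X ≠ OnePoint.infty) :
    IsLocalFirstIntegral η (X, Y) fun q => coord q.1 - G q.2 := by
  obtain ⟨x, rfl⟩ := OnePoint.ne_infty_iff_exists.1 hX
  have hsmooth : ContMDiffAt (𝓘(ℂ, ℂ).prod 𝓘(ℂ, ℂ)) 𝓘(ℂ, ℂ) ω
      (fun q : P1 × P1 => coord q.1 - G q.2) ((x : P1), Y) :=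
    ContMDiffAt.sub
      (ContMDiffAt.comp (g := coord) ((x : P1), Y) (contMDiffAt_coordAt false x) contMDiffAt_fst)
      (ContMDiffAt.comp (g := G) ((x : P1), Y) hG.1 contMDiffAt_snd)
  refine ⟨hsmooth, ?_, ?_⟩
  · intro h0
    -- Restricting to the line `u ↦ (u, Y)` shows that the differential is nonzero: there the
    -- function is `u - G Y`.
    have hc : MDifferentiableAt 𝓘(ℂ, ℂ) (𝓘(ℂ, ℂ).prod 𝓘(ℂ, ℂ)) (fun u : ℂ => ((u : P1), Y)) x :=
      MDifferentiableAt.prodMk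
        ((contMDiff_param false).contMDiffAt.mdifferentiableAt (by simp)) mdifferentiableAt_const
    have h1 := mfderiv_comp (f := fun u : ℂ => ((u : P1), Y)) x
      (hsmooth.mdifferentiableAt (by simp)) hc
    have h2 := h1.trans ((congrArg (fun l : ℂ × ℂ →L[ℂ] ℂ => l.comp _) h0).trans
      (ContinuousLinearMap.zero_comp _))
    rw [mfderiv_eq_fderiv] at h2
    have h3 : HasDerivAt (fun u : ℂ => u - G Y) 1 x := (hasDerivAt_id x).sub_const _
    have h4 : fderiv ℂ (fun u : ℂ => u - G Y) x 1 = 0 :=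
      congrArg (fun l : ℂ →L[ℂ] ℂ => l 1) h2
    rw [h3.hasFDerivAt.fderiv] at h4
    simp at h4
  · filter_upwards [(continuous_snd.tendsto ((x : P1), Y)).eventually hG.eventually]
      with q hq x' y' hq' hy' v hv
    subst hq'
    have h1 := ((MeromorphicOneForm.isPrimitiveAt_param (b := false)).1 hq).1.differentiableAt
      |>.hasDerivAt
    have h2 : HasFDerivAt (fun z : ℂ × ℂ => G (z.2 : P1))
        (deriv (fun z : ℂ => G (z : P1)) y' • ContinuousLinearMap.snd ℂ ℂ ℂ) (x', y') :=
      HasDerivAt.comp_hasFDerivAt (f := Prod.snd) (x', y') h1 hasFDerivAt_snd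
    have h3 : HasFDerivAt (fun z : ℂ × ℂ => coord (z.1 : P1) - G (z.2 : P1)) _ (x', y') :=
      (hasFDerivAt_fst (𝕜 := ℂ)).sub h2
    rw [h3.fderiv, hq.deriv_coe_eq hy']
    simpa using hv

/-- The fibre over `∞` is invariant, so a first integral has zero derivative along it. -/
theorem IsTransverseAt.ne_infty {X Y : P1} (h : IsTransverseAt η X Y) : X ≠ OnePoint.infty := by
  rintro rfl
  obtain ⟨f, hf, hne⟩ := h
  obtain ⟨b, y, -, rfl⟩ := exists_param Y
  have h0 : (OnePoint.infty : P1) = param true 0 := by simp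
  rw [h0] at hf hne
  have ha := hf.analyticAt_chartRep.deriv_snd
  refine hne ((mfderiv_param_eq_zero_iff ?_).2 ?_)
  · rw [contMDiffAt_iff_analyticAt_comp_param]
    exact AnalyticAt.comp (f := fun w => ((0 : ℂ), w)) (x := y) hf.analyticAt_chartRep
      (analyticAt_const.prod analyticAt_id)
  · exact ha.deriv.trans hf.eventually_fderiv_infty.self_of_nhds

/-- Over the regular points of `η`, the fibre of `dx = 0` is transverse to the foliation precisely
where `η` does not vanish. -/
theorem isTransverseAt_iff {X Y : P1} (hX : X ≠ OnePoint.infty) {G : P1 → ℂ}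
    (hG : η.IsPrimitiveAt G Y) :
    IsTransverseAt η X Y ↔ mfderiv 𝓘(ℂ, ℂ) 𝓘(ℂ, ℂ) G Y ≠ 0 := by
  obtain ⟨x, rfl⟩ := OnePoint.ne_infty_iff_exists.1 hX
  obtain ⟨b, y, -, rfl⟩ := exists_param Y
  constructor
  · rintro ⟨f, hf, hne⟩ h0
    rw [mfderiv_param_eq_zero_iff hG.1] at h0
    change IsLocalFirstIntegral η (param false x, param b y) f at hf
    refine hne ((mfderiv_param_eq_zero_iff ?_).2 ?_)
    · rw [contMDiffAt_iff_analyticAt_comp_param]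
      exact AnalyticAt.comp (f := fun w => (x, w)) (x := y) hf.analyticAt_chartRep
        (analyticAt_const.prod analyticAt_id)
    · refine hf.analyticAt_chartRep.deriv_snd.deriv.trans ?_
      have := (hf.eventually_fderiv_primitive hG).self_of_nhds
      simpa [h0] using this
  · intro hne
    refine ⟨_, hG.isLocalFirstIntegral hX, fun h => hne ?_⟩
    have ha := (MeromorphicOneForm.isPrimitiveAt_param.1 hG).1
    rw [mfderiv_param_eq_zero_iff hG.1]
    rw [mfderiv_param_eq_zero_iff] at h
    · have h1 := ha.differentiableAt.hasDerivAt.const_sub (coord (x : P1))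
      rw [h1.deriv] at h
      exact neg_eq_zero.1 h
    · rw [contMDiffAt_iff_analyticAt_comp_param]
      exact analyticAt_const.sub ha

end

/-! ### Leafwise paths over the regular points of `η` -/

theorem P1.continuousAt_coord {X : P1} (hX : X ≠ OnePoint.infty) : ContinuousAt coord X := by
  obtain ⟨x, rfl⟩ := OnePoint.ne_infty_iff_exists.1 hX
  exact (contMDiffAt_coordAt false x).continuousAt

/-- Connectedness of the interval, as a single form of the open-closed argument, for times on a
leafwise path and for the parameter of `τ`. -/
theorem forall_unitInterval_of_eventually_iff {P : I → Prop} (h : ∀ t, ∀ᶠ s in 𝓝 t, (P s ↔ P t))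
    (h0 : P 0) (t : I) : P t := by
  have hlc : IsLocallyConstant P :=
    (IsLocallyConstant.iff_eventually_eq P).2 fun t => (h t).mono fun s hs => propext hs
  rw [hlc.apply_eq_of_preconnectedSpace t 0]
  exact h0

namespace MeromorphicOneForm

/-- The set of points `(x, y)` with `x` finite and `η` holomorphic at `y`. -/
def finiteRegularSet (η : MeromorphicOneForm) : Set (P1 × P1) :=
  {q | q.1 ≠ OnePoint.infty ∧ ∃ G, η.IsPrimitiveAt G q.2}

theorem isOpen_finiteRegularSet (η : MeromorphicOneForm) : IsOpen η.finiteRegularSet := by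
  rw [isOpen_iff_mem_nhds]
  rintro q ⟨h1, G, hG⟩
  filter_upwards [(continuous_fst.tendsto q).eventually (isOpen_compl_singleton.mem_nhds h1),
    (continuous_snd.tendsto q).eventually hG.eventually] with q' h2 h3
  exact ⟨h2, G, h3⟩

end MeromorphicOneForm

variable {η : MeromorphicOneForm}

variable (η) in
/-- A continuous path along which `dx = η(y)`, in the set where `x` is finite and `η` is
holomorphic at `y`. -/
def IsHorizontal (γ : I → P1 × P1) : Prop :=
  Continuous γ ∧ ∀ t, γ t ∈ η.finiteRegularSet ∧ ∀ G, η.IsPrimitiveAt G (γ t).2 →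
    ∀ᶠ s in 𝓝 t, coord (γ s).1 - G (γ s).2 = coord (γ t).1 - G (γ t).2

/-- One primitive at each time suffices, since two of them differ by a local constant. -/
theorem isHorizontal_of_exists {γ : I → P1 × P1} (hγ : Continuous γ)
    (h : ∀ t, (γ t).1 ≠ OnePoint.infty ∧ ∃ G, η.IsPrimitiveAt G (γ t).2 ∧
      ∀ᶠ s in 𝓝 t, coord (γ s).1 - G (γ s).2 = coord (γ t).1 - G (γ t).2) : IsHorizontal η γ := by
  refine ⟨hγ, fun t => ?_⟩
  obtain ⟨h1, G, hG, h2⟩ := h t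
  refine ⟨⟨h1, G, hG⟩, fun K hK => ?_⟩
  filter_upwards [h2, ((continuous_snd.comp hγ).tendsto t).eventually (hG.eventually_sub_eq hK)]
    with s h3 h4
  simp only [Function.comp_apply] at h4
  linear_combination h3 + h4

theorem IsHorizontal.isLeafwisePath {γ : I → P1 × P1} (hγ : IsHorizontal η γ) :
    IsLeafwisePath η γ := by
  refine ⟨hγ.1, fun t => ?_⟩
  obtain ⟨⟨h1, G, hG⟩, h2⟩ := hγ.2 t
  exact ⟨_, hG.isLocalFirstIntegral h1, h2 G hG⟩

/-- A leafwise path that starts over a regular point of `η` with finite `x` stays over such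
points. -/
theorem IsLeafwisePath.mem_finiteRegularSet {γ : I → P1 × P1} (hγ : IsLeafwisePath η γ)
    (h0 : γ 0 ∈ η.finiteRegularSet) (t : I) : γ t ∈ η.finiteRegularSet := by
  refine forall_unitInterval_of_eventually_iff (P := fun t => γ t ∈ η.finiteRegularSet) ?_ h0 t
  intro t
  by_cases ht : γ t ∈ η.finiteRegularSet
  · filter_upwards [hγ.1.continuousAt.eventually (η.isOpen_finiteRegularSet.mem_nhds ht)] with s hs
    exact iff_of_true hs ht
  -- Outside the set, the point lies on an invariant line, and the path locally stays on that line.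
  · obtain ⟨f, hf, hs⟩ := hγ.2 t
    obtain ⟨⟨X, Y⟩, hXY⟩ : ∃ q, q = γ t := ⟨_, rfl⟩
    rw [← hXY] at ht hf hs
    have hc := hγ.1.tendsto t
    rw [← hXY] at hc
    rw [← hXY]
    by_cases hX : X = OnePoint.infty
    · subst hX
      filter_upwards [hc.eventually hf.eventually_fst_eq_infty, hs] with s h1 h2
      exact iff_of_false (fun h => h.1 (h1 h2)) ht
    · have hY : ¬ ∃ G, η.IsPrimitiveAt G Y := fun h => ht ⟨hX, h⟩
      have hYp : Y ∈ η.poles := by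
        by_contra hYp
        exact hY (MeromorphicOneForm.exists_isPrimitiveAt hYp)
      filter_upwards [hc.eventually (hf.eventually_snd_eq_of_mem_poles hYp), hs] with s h1 h2
      exact iff_of_false (fun h => hY (h1 h2 ▸ h.2)) ht

theorem IsLeafwisePath.isHorizontal {γ : I → P1 × P1} (hγ : IsLeafwisePath η γ)
    (h0 : γ 0 ∈ η.finiteRegularSet) : IsHorizontal η γ := by
  refine ⟨hγ.1, fun t => ⟨hγ.mem_finiteRegularSet h0 t, fun G hG => ?_⟩⟩
  obtain ⟨f, hf, hs⟩ := hγ.2 t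
  filter_upwards [hs, (hγ.1.tendsto t).eventually
    (IsLocalFirstIntegral.eventually_sub_primitive_eq (X := (γ t).1) (Y := (γ t).2) hf
      (hγ.mem_finiteRegularSet h0 t).1 hG)] with s h1 h2
  exact h2 h1

/-! ### Translation, lifting and concatenation of horizontal paths. -/

namespace IsHorizontal

/-- The form `dx - η(y)` is invariant under translations in `x`. -/
theorem add_const {γ : I → P1 × P1} (hγ : IsHorizontal η γ) (c : ℂ) :
    IsHorizontal η fun s => (((coord (γ s).1 + c : ℂ) : P1), (γ s).2) := by
  refine isHorizontal_of_exists ?_ fun t => ?_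
  · refine Continuous.prodMk ?_ (continuous_snd.comp hγ.1)
    refine OnePoint.continuous_coe.comp (Continuous.add ?_ continuous_const)
    refine continuous_iff_continuousAt.2 fun t => ?_
    exact ContinuousAt.comp (f := fun s => (γ s).1) (continuousAt_coord (hγ.2 t).1.1)
      (continuous_fst.comp hγ.1).continuousAt
  · obtain ⟨⟨h1, G, hG⟩, h2⟩ := hγ.2 t
    refine ⟨OnePoint.coe_ne_infty _, G, hG, ?_⟩
    filter_upwards [h2 G hG] with s hs
    simp only [coord_coe]
    linear_combination hs

/-- The lift of a path in the domain of a primitive of `η`. -/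
theorem of_primitive {c : I → P1} (hc : Continuous c) {G : P1 → ℂ}
    (hG : ∀ t, η.IsPrimitiveAt G (c t)) (u : ℂ) :
    IsHorizontal η fun s => (((u + G (c s) : ℂ) : P1), c s) := by
  refine isHorizontal_of_exists ?_ fun t => ⟨OnePoint.coe_ne_infty _, G, hG t, ?_⟩
  · refine Continuous.prodMk (OnePoint.continuous_coe.comp (continuous_const.add ?_)) hc
    exact continuous_iff_continuousAt.2 fun t =>
      ContinuousAt.comp (f := c) (hG t).1.continuousAt hc.continuousAt
  · exact Eventually.of_forall fun s => by simp

theorem trans {p q r : P1 × P1} {γ₁ : Path p q} {γ₂ : Path q r} (h₁ : IsHorizontal η γ₁)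
    (h₂ : IsHorizontal η γ₂) : IsHorizontal η (γ₁.trans γ₂) := by
  -- Clamping makes both reparametrizations continuous on the whole interval, and each formula is
  -- valid on a closed half, midpoint included.
  set α : I → I := fun s => projIcc 0 1 zero_le_one (2 * (s : ℝ)) with hα
  set β : I → I := fun s => projIcc 0 1 zero_le_one (2 * (s : ℝ) - 1) with hβ
  have hαc : Continuous α := continuous_projIcc.comp (by fun_prop)
  have hβc : Continuous β := continuous_projIcc.comp (by fun_prop)
  have e1 : ∀ s : I, (s : ℝ) ≤ 1 / 2 → γ₁.trans γ₂ s = γ₁ (α s) := by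
    intro s hs
    rw [Path.trans_apply, dif_pos hs, hα]
    exact congrArg γ₁ (projIcc_of_mem zero_le_one _).symm
  have e2 : ∀ s : I, 1 / 2 ≤ (s : ℝ) → γ₁.trans γ₂ s = γ₂ (β s) := by
    intro s hs
    rcases hs.eq_or_lt with h | h
    · rw [e1 s h.ge, hα, hβ]
      simp only [← h]
      norm_num
    · rw [Path.trans_apply, dif_neg (not_le.2 h), hβ]
      exact congrArg γ₂ (projIcc_of_mem zero_le_one _).symm
  refine ⟨(γ₁.trans γ₂).continuous, fun t => ⟨?_, fun G hG => ?_⟩⟩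
  · rcases le_total (t : ℝ) (1 / 2) with h | h
    · rw [e1 t h]; exact (h₁.2 _).1
    · rw [e2 t h]; exact (h₂.2 _).1
  · have hval : Continuous fun s : I => (s : ℝ) := continuous_subtype_val
    have c1 : ∀ᶠ s : I in 𝓝 t, (s : ℝ) ≤ 1 / 2 → coord (γ₁.trans γ₂ s).1 - G (γ₁.trans γ₂ s).2 =
        coord (γ₁.trans γ₂ t).1 - G (γ₁.trans γ₂ t).2 := by
      rcases le_or_gt (t : ℝ) (1 / 2) with h | h
      · rw [e1 t h] at hG ⊢
        filter_upwards [(hαc.tendsto t).eventually ((h₁.2 (α t)).2 G hG)] with s hs hs'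
        rw [e1 s hs']
        exact hs
      · filter_upwards [(hval.tendsto t).eventually (lt_mem_nhds h)] with s hs hs'
        exact absurd hs' (not_le.2 hs)
    have c2 : ∀ᶠ s : I in 𝓝 t, 1 / 2 ≤ (s : ℝ) → coord (γ₁.trans γ₂ s).1 - G (γ₁.trans γ₂ s).2 =
        coord (γ₁.trans γ₂ t).1 - G (γ₁.trans γ₂ t).2 := by
      rcases le_or_gt (1 / 2) (t : ℝ) with h | h
      · rw [e2 t h] at hG ⊢
        filter_upwards [(hβc.tendsto t).eventually ((h₂.2 (β t)).2 G hG)] with s hs hs'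
        rw [e2 s hs']
        exact hs
      · filter_upwards [(hval.tendsto t).eventually (gt_mem_nhds h)] with s hs hs'
        exact absurd hs' (not_le.2 hs)
    filter_upwards [c1, c2] with s h1 h2
    exact (le_total (s : ℝ) (1 / 2)).elim h1 h2

end IsHorizontal

/-! ### Leafwise transport and conservation of `η` -/

/-- Leafwise transport from one fibre of `dx = 0` to another one preserves `η`. -/
theorem IsLeafwiseTransport.preserves {x₀ x₁ p : P1} {h : P1 → P1}
    (hh : IsLeafwiseTransport η x₀ x₁ p h) (hx₀ : x₀ ≠ OnePoint.infty)
    {G : P1 → ℂ} (hG : η.IsPrimitiveAt G p) :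
    (x₁, h p) ∈ η.finiteRegularSet ∧ ∀ K, η.IsPrimitiveAt K (h p) →
      ∀ᶠ q in 𝓝 p, K (h q) - G q = K (h p) - G p := by
  obtain ⟨U, hU, Γ, hΓc, hΓ⟩ := hh
  have hpU : p ∈ U := mem_of_mem_nhds hU
  have hhor : ∀ y ∈ U, η.IsPrimitiveAt G y → IsHorizontal η (Γ y) := fun y hy hGy =>
    (hΓ y hy).1.isHorizontal (by rw [(hΓ y hy).2.1]; exact ⟨hx₀, G, hGy⟩)
  have hp := hhor p hpU hG
  have hcont : ∀ t : I, ContinuousAt (fun z : P1 × I => Γ z.1 z.2) (p, t) := fun t =>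
    hΓc.continuousAt (prod_mem_nhds hU univ_mem)
  have hcy : ∀ t : I, ContinuousAt (fun y => Γ y t) p := fun t =>
    ContinuousAt.comp (f := fun y => (y, t)) (g := fun z : P1 × I => Γ z.1 z.2) (hcont t)
      (by fun_prop)
  have hindep : ∀ (t : I) (K K' : P1 → ℂ), η.IsPrimitiveAt K (Γ p t).2 →
      η.IsPrimitiveAt K' (Γ p t).2 → ∀ᶠ y in 𝓝 p,
        K (Γ y t).2 - K' (Γ y t).2 = K (Γ p t).2 - K' (Γ p t).2 := fun t K K' hK hK' =>
    ((continuous_snd.tendsto _).comp (hcy t)).eventually (hK.eventually_sub_eq hK')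
  -- The invariant is `x - K(y)` at time `t` plus `G` at the starting point, locally constant in the
  -- starting point. At both ends `x` is fixed: at `t = 0` this compares two primitives, and at `t =
  -- 1` it is the conclusion.
  have key : ∀ t : I, ∀ K, η.IsPrimitiveAt K (Γ p t).2 → ∀ᶠ y in 𝓝 p,
      coord (Γ y t).1 - K (Γ y t).2 + G y = coord (Γ p t).1 - K (Γ p t).2 + G p := by
    refine forall_unitInterval_of_eventually_iff ?_ ?_
    · intro t
      -- On a product of a neighbourhood of `p` and an interval `J` around `t`, one primitive `K₀`
      -- serves all paths. Each path then has constant `x - K₀(y)` over the connected `J`, so the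
      -- condition is the same throughout `J`.
      obtain ⟨⟨-, K₀, hK₀⟩, -⟩ := hp.2 t
      have hW : ∀ᶠ z in 𝓝 (p, t), η.IsPrimitiveAt K₀ (Γ z.1 z.2).2 :=
        ((continuous_snd.tendsto _).comp (hcont t)).eventually hK₀.eventually
      rw [nhds_prod_eq] at hW
      obtain ⟨V, hV, W, hWt, hVW⟩ := eventually_prod_iff.1 hW
      obtain ⟨J, hJ, hJt, hJc⟩ : ∃ J ∈ 𝓝 t, (∀ s ∈ J, W s) ∧ IsPreconnected J := by
        obtain ⟨ε, hε, hball⟩ := Metric.eventually_nhds_iff_ball.1 hWt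
        refine ⟨Metric.ball t ε, Metric.ball_mem_nhds t hε, hball, ?_⟩
        rw [← IsInducing.subtypeVal.isPreconnected_image]
        have himg : ((↑) : I → ℝ) '' Metric.ball t ε = Metric.ball (t : ℝ) ε ∩ Icc 0 1 := by
          rw [← Subtype.preimage_ball, Subtype.image_preimage_coe, inter_comm]
        rw [himg]
        exact ((convex_ball _ _).inter (convex_Icc 0 1)).isPreconnected
      have hVp : V p := hV.self_of_nhds
      have hconst : ∀ y ∈ U, η.IsPrimitiveAt G y → V y → ∀ s ∈ J,
          coord (Γ y s).1 - K₀ (Γ y s).2 = coord (Γ y t).1 - K₀ (Γ y t).2 := by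
        intro y hy hGy hVy s hs
        have : PreconnectedSpace J := Subtype.preconnectedSpace hJc
        have hlc : IsLocallyConstant fun j : J => coord (Γ y j).1 - K₀ (Γ y j).2 := by
          refine (IsLocallyConstant.iff_eventually_eq _).2 fun j => ?_
          exact continuous_subtype_val.continuousAt.eventually
            (((hhor y hy hGy).2 j).2 K₀ (hVW hVy (hJt j j.2)))
        exact hlc.apply_eq_of_preconnectedSpace ⟨s, hs⟩ ⟨t, mem_of_mem_nhds hJ⟩
      have hK₀iff : ∀ s ∈ J, ((∀ K, η.IsPrimitiveAt K (Γ p s).2 → ∀ᶠ y in 𝓝 p,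
          coord (Γ y s).1 - K (Γ y s).2 + G y = coord (Γ p s).1 - K (Γ p s).2 + G p) ↔
          ∀ᶠ y in 𝓝 p, coord (Γ y s).1 - K₀ (Γ y s).2 + G y =
            coord (Γ p s).1 - K₀ (Γ p s).2 + G p) := by
        intro s hs
        have hKs := hVW hVp (hJt s hs)
        refine ⟨fun h => h K₀ hKs, fun h K hK => ?_⟩
        filter_upwards [h, hindep s K K₀ hK hKs] with y h1 h2
        linear_combination h1 - h2
      filter_upwards [hJ] with s hs
      rw [hK₀iff s hs, hK₀iff t (mem_of_mem_nhds hJ)]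
      refine eventually_congr ?_
      filter_upwards [hU, hG.eventually, hV] with y hy hGy hVy
      rw [hconst y hy hGy hVy s hs, hconst p hpU hG hVp s hs]
    · intro K hK
      rw [(hΓ p hpU).2.1] at hK ⊢
      filter_upwards [hU, hG.eventually_sub_eq hK] with y hy h1
      rw [(hΓ y hy).2.1]
      linear_combination h1
  refine ⟨?_, fun K hK => ?_⟩
  · rw [← (hΓ p hpU).2.2]
    exact (hp.2 1).1
  · have h1 := key 1 K (by rw [(hΓ p hpU).2.2]; exact hK)
    rw [(hΓ p hpU).2.2] at h1
    filter_upwards [h1, hU] with y hy hyU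
    rw [(hΓ y hyU).2.2] at hy
    linear_combination -hy

/-! ### Continuous families of horizontal paths. -/

variable (η) in
/-- There is a continuous family of horizontal paths from the points `a v` to the points `b v`. -/
def HasHorizontalFamily {ι : Type*} [TopologicalSpace ι] (a b : ι → P1 × P1) : Prop :=
  ∃ Γ : ∀ v, Path (a v) (b v), Continuous (fun y : ι × I => Γ y.1 y.2) ∧
    ∀ v, IsHorizontal η (Γ v)

namespace HasHorizontalFamily

variable {ι : Type*} [TopologicalSpace ι] {a b c : ι → P1 × P1}

theorem mk (Γ : ι × I → P1 × P1) (hΓ : Continuous Γ) (hor : ∀ v, IsHorizontal η fun s => Γ (v, s))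
    (ha : ∀ v, Γ (v, 0) = a v) (hb : ∀ v, Γ (v, 1) = b v) : HasHorizontalFamily η a b :=
  ⟨fun v => ⟨⟨fun s => Γ (v, s), (hor v).1⟩, ha v, hb v⟩, hΓ, hor⟩

theorem trans (h₁ : HasHorizontalFamily η a b) (h₂ : HasHorizontalFamily η b c) :
    HasHorizontalFamily η a c := by
  obtain ⟨Γ₁, c₁, h₁⟩ := h₁
  obtain ⟨Γ₂, c₂, h₂⟩ := h₂
  exact ⟨fun v => (Γ₁ v).trans (Γ₂ v), Path.trans_continuous_family Γ₁ c₁ Γ₂ c₂,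
    fun v => (h₁ v).trans (h₂ v)⟩

theorem of_primitive {f : ι × I → P1} (hf : Continuous f) {G : P1 → ℂ}
    (hG : ∀ y, η.IsPrimitiveAt G (f y)) {u : ι → ℂ} (hu : Continuous u) :
    HasHorizontalFamily η (fun v => (((u v + G (f (v, 0)) : ℂ) : P1), f (v, 0)))
      fun v => (((u v + G (f (v, 1)) : ℂ) : P1), f (v, 1)) := by
  refine mk (fun y => (((u y.1 + G (f y) : ℂ) : P1), f y)) ?_ ?_ (fun _ => rfl) (fun _ => rfl)
  · refine Continuous.prodMk (OnePoint.continuous_coe.comp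
      (Continuous.add (hu.comp continuous_fst) ?_)) hf
    exact continuous_iff_continuousAt.2 fun y =>
      ContinuousAt.comp (f := f) (hG y).1.continuousAt hf.continuousAt
  · intro v
    have h1 : Continuous fun s : I => (v, s) := by fun_prop
    exact IsHorizontal.of_primitive (hf.comp h1) (fun s => hG (v, s)) (u v)

theorem of_isHorizontal {γ : I → P1 × P1} (hγ : IsHorizontal η γ) {u : ι → ℂ}
    (hu : Continuous u) :
    HasHorizontalFamily η (fun v => (((coord (γ 0).1 + u v : ℂ) : P1), (γ 0).2))
      fun v => (((coord (γ 1).1 + u v : ℂ) : P1), (γ 1).2) := by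
  refine mk (fun y => (((coord (γ y.2).1 + u y.1 : ℂ) : P1), (γ y.2).2)) ?_ ?_ (fun _ => rfl)
    (fun _ => rfl)
  · have hγc : Continuous fun s => coord (γ s).1 := continuous_iff_continuousAt.2 fun t =>
      ContinuousAt.comp (f := fun s => (γ s).1) (continuousAt_coord (hγ.2 t).1.1)
        (continuous_fst.comp hγ.1).continuousAt
    exact (OnePoint.continuous_coe.comp ((hγc.comp continuous_snd).add
      (hu.comp continuous_fst))).prodMk ((continuous_snd.comp hγ.1).comp continuous_snd)
  · exact fun v => hγ.add_const (u v)

theorem isLeafwiseTransport {x₀ x₁ p : P1} {H : P1 → P1} {U : Set P1} (hU : U ∈ 𝓝 p)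
    (h : HasHorizontalFamily η (fun y : U => (x₀, (y : P1))) fun y => (x₁, H y)) :
    IsLeafwiseTransport η x₀ x₁ p H := by
  obtain ⟨Γ, hc, hor⟩ := h
  classical
  -- The value `(y, y)` outside `U` is arbitrary.
  refine ⟨U, hU, fun y s => if hy : y ∈ U then Γ ⟨y, hy⟩ s else (y, y), ?_, fun y hy => ?_⟩
  · rw [continuousOn_iff_continuous_domRestrict]
    have h1 : Continuous fun y : U ×ˢ (univ : Set I) => ((⟨y.1.1, y.2.1⟩, y.1.2) : U × I) :=
      (Continuous.subtype_mk (continuous_fst.comp continuous_subtype_val) _).prodMk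
        (continuous_snd.comp continuous_subtype_val)
    refine (hc.comp h1).congr fun y => ?_
    simp only [Function.comp_apply, domRestrict_apply, dif_pos y.2.1]
  · have e : (fun s => if hy : y ∈ U then Γ ⟨y, hy⟩ s else (y, y)) = Γ ⟨y, hy⟩ :=
      funext fun s => dif_pos hy
    simp only [e]
    simp only [dif_pos hy]
    exact ⟨(hor ⟨y, hy⟩).isLeafwisePath, (Γ ⟨y, hy⟩).source, (Γ ⟨y, hy⟩).target⟩

end HasHorizontalFamily

/-- If `H` preserves `η` near `p`, then a single leafwise path from `(x₀, q)` to `(x₁, H q)` with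
`q` near `p` yields leafwise transport near all points near `p`. -/
theorem exists_nhds_isLeafwiseTransport {H : P1 → P1} {p : P1} {G K : P1 → ℂ}
    (hG : η.IsPrimitiveAt G p) (hK : η.IsPrimitiveAt K (H p)) (hH : ∀ᶠ q in 𝓝 p, ContinuousAt H q)
    (hKG : ∀ᶠ q in 𝓝 p, K (H q) - G q = K (H p) - G p) (x₀ x₁ : P1) :
    ∃ D ∈ 𝓝 p, ∀ q ∈ D, ∀ q' ∈ D,
      (∃ γ, IsHorizontal η γ ∧ γ 0 = (x₀, q) ∧ γ 1 = (x₁, H q)) →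
      IsLeafwiseTransport η x₀ x₁ q' H := by
  obtain ⟨b, z, -, rfl⟩ := exists_param p
  have hev : ∀ᶠ q in 𝓝 (param b z), η.IsPrimitiveAt G q ∧ η.IsPrimitiveAt K (H q) ∧
      ContinuousAt H q ∧ K (H q) - G q = K (H (param b z)) - G (param b z) := by
    filter_upwards [hG.eventually, hH.self_of_nhds.eventually hK.eventually, hH, hKG]
      with q h1 h2 h3 h4 using ⟨h1, h2, h3, h4⟩
  obtain ⟨r, hr, hball⟩ := Metric.eventually_nhds_iff_ball.1 (eventually_nhds_param.1 hev)
  -- The image of a disc, so that points of `D` can be joined by segments in the chart.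
  set D : Set P1 := param b '' Metric.ball z r with hD
  have hDo : IsOpen D := (isOpenEmbedding_param b).isOpenMap _ Metric.isOpen_ball
  have hDP : ∀ q ∈ D, η.IsPrimitiveAt G q ∧ η.IsPrimitiveAt K (H q) ∧
      ContinuousAt H q ∧ K (H q) - G q = K (H (param b z)) - G (param b z) := by
    rintro _ ⟨w, hw, rfl⟩
    exact hball w hw
  refine ⟨D, hDo.mem_nhds ⟨z, Metric.mem_ball_self hr, rfl⟩, ?_⟩
  rintro q ⟨w, hw, rfl⟩ q' hq' ⟨γ, hγ, hγ0, hγ1⟩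
  have hx₀ : x₀ ≠ OnePoint.infty := by simpa [hγ0] using (hγ.2 0).1.1
  have hx₁ : x₁ ≠ OnePoint.infty := by simpa [hγ1] using (hγ.2 1).1.1
  obtain ⟨u₀, rfl⟩ := OnePoint.ne_infty_iff_exists.1 hx₀
  obtain ⟨u₁, rfl⟩ := OnePoint.ne_infty_iff_exists.1 hx₁
  -- the segments from the points of `D` to `q`
  obtain ⟨seg, hsegc, hsegD, hseg0, hseg1⟩ : ∃ seg : D × I → P1, Continuous seg ∧
      (∀ y, seg y ∈ D) ∧ (∀ v, seg (v, 0) = v) ∧ ∀ v, seg (v, 1) = param b w := by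
    have hcc : Continuous fun v : D => coordAt b v := by
      refine ContinuousOn.comp_continuous (g := coordAt b) (s := D) ?_ continuous_subtype_val
        fun v => v.2
      rintro _ ⟨v, -, rfl⟩
      exact (contMDiffAt_coordAt b v).continuousAt.continuousWithinAt
    have hcm : ∀ v : D, coordAt b v ∈ Metric.ball z r := by
      rintro ⟨_, v, hv, rfl⟩
      simpa using hv
    refine ⟨fun y => param b ((1 - (y.2 : ℝ)) • coordAt b y.1 + (y.2 : ℝ) • w), ?_, ?_, ?_, ?_⟩
    · refine (continuous_param b).comp ?_
      have h1 : Continuous fun y : D × I => coordAt b y.1 := hcc.comp continuous_fst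
      fun_prop
    · exact fun y => ⟨_, convex_ball z r (hcm y.1) hw (sub_nonneg.2 y.2.2.2) y.2.2.1 (by ring), rfl⟩
    · rintro ⟨_, v, hv, rfl⟩
      simp
    · intro v
      simp
  have hGc : Continuous fun v : D => G v := continuous_iff_continuousAt.2 fun v =>
    ContinuousAt.comp (f := fun v : D => (v : P1)) (hDP v v.2).1.1.continuousAt
      continuous_subtype_val.continuousAt
  have hHs : Continuous fun y : D × I => H (seg (y.1, σ y.2)) := by
    have h1 : Continuous fun y : D × I => seg (y.1, σ y.2) :=
      hsegc.comp (continuous_fst.prodMk (unitInterval.continuous_symm.comp continuous_snd))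
    exact continuous_iff_continuousAt.2 fun y =>
      ContinuousAt.comp (f := fun y : D × I => seg (y.1, σ y.2)) (hDP _ (hsegD _)).2.2.1
        h1.continuousAt
  -- With `q = param b w`: `F₁` lifts the segment from `v` to `q`, `F₂` is `γ` shifted by `G q - G
  -- v`, and `F₃` lifts the `H`-image of the reversed segment. The constants make consecutive ends
  -- agree; the last end has `x = u₁` by the constancy of `K ∘ H - G`.
  have F₁ := HasHorizontalFamily.of_primitive (u := fun v : D => u₀ - G v) hsegc
    (fun y => (hDP _ (hsegD y)).1) (continuous_const.sub hGc)
  have F₂ := HasHorizontalFamily.of_isHorizontal hγ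
    (u := fun v : D => G (param b w) - G v) (continuous_const.sub hGc)
  have F₃ := HasHorizontalFamily.of_primitive
    (u := fun v : D => u₁ + G (param b w) - G v - K (H (param b w))) hHs
    (fun y => (hDP _ (hsegD _)).2.1) ((continuous_const.sub hGc).sub continuous_const)
  simp only [hseg0, hseg1, hγ0, hγ1, coord_coe, unitInterval.symm_zero, unitInterval.symm_one]
    at F₁ F₂ F₃
  refine HasHorizontalFamily.isLeafwiseTransport (hDo.mem_nhds hq') ?_
  have e₁ : ∀ v : D, u₀ - G v + G v = u₀ := fun v => by ring
  have e₂ : ∀ v : D, u₀ - G v + G (param b w) = u₀ + (G (param b w) - G v) := fun v => by ring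
  have e₃ : ∀ v : D, u₁ + G (param b w) - G v - K (H (param b w)) + K (H (param b w)) =
    u₁ + (G (param b w) - G v) := fun v => by ring
  have e₄ : ∀ v : D, u₁ + G (param b w) - G v - K (H (param b w)) + K (H v) = u₁ := fun v => by
    have h1 := (hDP v v.2).2.2.2.trans (hDP (param b w) ⟨w, hw, rfl⟩).2.2.2.symm
    linear_combination h1
  simp only [e₁, e₂] at F₁
  simp only [e₃, e₄] at F₃
  exact (F₁.trans F₂).trans F₃

/-! ### Germs of maps that preserve `η` -/

namespace MeromorphicOneForm

/-- A form with a primitive whose differential does not vanish somewhere is nowhere locally zero. -/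
theorem IsPrimitiveAt.meromorphicOrderAt_ne_top {G : P1 → ℂ} {p : P1} (hG : η.IsPrimitiveAt G p)
    (hne : mfderiv 𝓘(ℂ, ℂ) 𝓘(ℂ, ℂ) G p ≠ 0) (c : Bool) (w : ℂ) :
    meromorphicOrderAt (η.coeffAt c) w ≠ ⊤ := by
  obtain ⟨b, z, -, rfl⟩ := exists_param p
  have h1 : meromorphicOrderAt (η.coeffAt b) z ≠ ⊤ := by
    intro htop
    rw [meromorphicOrderAt_eq_top_iff] at htop
    refine hne ((mfderiv_param_eq_zero_iff hG.1).2 ?_)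
    obtain ⟨hGa, hGd⟩ := isPrimitiveAt_param.1 hG
    have h2 : ∀ᶠ v in 𝓝[≠] z, deriv (fun w => G (param b w)) v = 0 := by
      filter_upwards [htop, hGd] with v h3 h4
      rw [h4, h3]
    have h3 := EventuallyEq.deriv_eq (hGa.eventually_eq_of_deriv_eq_zero h2)
    rw [h3, deriv_const]
  -- Finite order at one point of `ℂ` gives finite order everywhere. The point `1` belongs to both
  -- charts and passes this from one coefficient to the other.
  have h2 := (η.meromorphic_coeffAt b).exists_meromorphicOrderAt_ne_top_iff_forall.1 ⟨z, h1⟩ 1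
  have h3 : meromorphicOrderAt (η.coeffAt true) 1 = meromorphicOrderAt (η.coeffAt false) 1 := by
    simpa using η.meromorphicOrderAt_coeffInfty one_ne_zero
  refine (η.meromorphic_coeffAt c).exists_meromorphicOrderAt_ne_top_iff_forall.1 ⟨1, ?_⟩ w
  cases b <;> cases c <;> simp_all

variable (η) in
/-- `H` maps `q` to a regular point of `η`, and `H` preserves `η` near `q`. -/
def PreservedAt (H : P1 → P1) (q : P1) : Prop :=
  (∃ K, η.IsPrimitiveAt K (H q)) ∧ ∀ G K, η.IsPrimitiveAt G q → η.IsPrimitiveAt K (H q) →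
    ∀ᶠ r in 𝓝 q, K (H r) - G r = K (H q) - G q

theorem preservedAt_of_exists {H : P1 → P1} {q : P1} (hH : ContinuousAt H q) {G K : P1 → ℂ}
    (hG : η.IsPrimitiveAt G q) (hK : η.IsPrimitiveAt K (H q))
    (h : ∀ᶠ r in 𝓝 q, K (H r) - G r = K (H q) - G q) : η.PreservedAt H q := by
  refine ⟨⟨K, hK⟩, fun G' K' hG' hK' => ?_⟩
  filter_upwards [h, hG.eventually_sub_eq hG', hH.eventually (hK.eventually_sub_eq hK')]
    with r h1 h2 h3
  linear_combination h1 + h2 - h3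

theorem PreservedAt.congr {H H' : P1 → P1} {q : P1} (h : η.PreservedAt H q)
    (hH : H =ᶠ[𝓝 q] H') : η.PreservedAt H' q := by
  have h0 := hH.self_of_nhds
  refine ⟨h0 ▸ h.1, fun G K hG hK => ?_⟩
  filter_upwards [h.2 G K hG (h0.symm ▸ hK), hH] with r h1 h2
  rw [← h2, ← h0, h1]

/-- A nonconstant holomorphic map cannot pull back a pole to a regular point. -/
theorem meromorphicOrderAt_comp_mul_deriv_neg {k m : ℂ → ℂ} {w : ℂ} (hm : AnalyticAt ℂ m w)
    (hnc : ¬ EventuallyConst m (𝓝 w)) (hk : MeromorphicAt k (m w))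
    (hpole : meromorphicOrderAt k (m w) < 0) :
    meromorphicOrderAt (fun v => k (m v) * deriv m v) w < 0 := by
  have h1 := hk.meromorphicOrderAt_comp hm hnc
  have h2 := hm.analyticOrderAt_deriv_add_one
  have h3 : analyticOrderAt (m · - m w) w ≠ ⊤ := fun h =>
    hnc (eventuallyConst_iff_analyticOrderAt_sub_eq_top.2 h)
  have h4 : analyticOrderAt (deriv m) w ≠ ⊤ := by
    intro h; rw [h] at h2; exact h3 (by rw [← h2]; rfl)
  obtain ⟨e, he⟩ := ENat.ne_top_iff_exists.1 h4
  obtain ⟨n, hn⟩ := WithTop.ne_top_iff_exists.1 (ne_top_of_lt hpole)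
  rw [← h2, ← he, ← hn] at h1
  have h5 : meromorphicOrderAt (deriv m) w = ((e : ℤ) : WithTop ℤ) := by
    rw [hm.deriv.meromorphicOrderAt_eq, ← he]; rfl
  have h6 : ((e : ℕ∞) + 1).map (Nat.cast : ℕ → ℤ) = (((e + 1 : ℕ) : ℤ) : WithTop ℤ) := rfl
  -- If `k` has order `n ≤ -1` and `m - m w` has order `e + 1`, the pullback has order `n (e + 1) +
  -- e ≤ -1`.
  have h7 : meromorphicOrderAt (fun v => k (m v) * deriv m v) w =
      ((n * (e + 1) + e : ℤ) : WithTop ℤ) := by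
    have h8 : (fun v => k (m v) * deriv m v) = (k ∘ m) * deriv m := rfl
    rw [h8, meromorphicOrderAt_mul (hk.comp_analyticAt hm) hm.deriv.meromorphicAt, h1, h5, h6]
    push_cast
    rfl
  rw [h7]
  rw [← hn] at hpole
  have h9 : n < 0 := by exact_mod_cast hpole
  have h10 : n * (e + 1) + e < 0 := by nlinarith
  exact_mod_cast h10

/-- The condition that `H` preserves `η`, in coordinates. -/
theorem preservedAt_param_iff {H : P1 → P1} {b c : Bool} {w : ℂ} {m : ℂ → ℂ}
    (hm : AnalyticAt ℂ m w) (hHm : ∀ᶠ v in 𝓝 w, H (param b v) = param c (m v))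
    {G : P1 → ℂ} (hG : η.IsPrimitiveAt G (param b w))
    (hne : ∀ b w, meromorphicOrderAt (η.coeffAt b) w ≠ ⊤) :
    η.PreservedAt H (param b w) ↔
      ∀ᶠ v in 𝓝[≠] w, η.coeffAt c (m v) * deriv m v = η.coeffAt b v := by
  have hHw : H (param b w) = param c (m w) := hHm.self_of_nhds
  have hHc : ContinuousAt H (param b w) := by
    have h1 : Tendsto (fun v => param c (m v)) (𝓝 w) (𝓝 (param c (m w))) :=
      (continuous_param c).continuousAt.comp hm.continuousAt
    rw [ContinuousAt, nhds_param, hHw, tendsto_map'_iff]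
    exact h1.congr' (hHm.mono fun v hv => hv.symm)
  obtain ⟨hGa, hGd⟩ := isPrimitiveAt_param.1 hG
  have hGn : ¬ ∀ᶠ v in 𝓝[≠] w, η.coeffAt b v = 0 := fun h =>
    hne b w (meromorphicOrderAt_eq_top_iff.2 h)
  have hcomp : ∀ K, η.IsPrimitiveAt K (param c (m w)) →
      AnalyticAt ℂ (fun v => K (param c (m v)) - G (param b v)) w := fun K hK =>
    (AnalyticAt.comp (f := m) (isPrimitiveAt_param.1 hK).1 hm).sub hGa
  have hderiv : ¬ EventuallyConst m (𝓝 w) → ∀ K, η.IsPrimitiveAt K (param c (m w)) →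
      ∀ᶠ v in 𝓝[≠] w, deriv (fun v => K (param c (m v)) - G (param b v)) v =
        η.coeffAt c (m v) * deriv m v - η.coeffAt b v := by
    intro hnc K hK
    obtain ⟨hKa, hKd⟩ := isPrimitiveAt_param.1 hK
    have ht : Tendsto m (𝓝[≠] w) (𝓝[≠] (m w)) := hm.map_nhdsNE hnc
    filter_upwards [ht.eventually hKd, hGd,
      hm.eventually_analyticAt.filter_mono nhdsWithin_le_nhds,
      hGa.eventually_analyticAt.filter_mono nhdsWithin_le_nhds,
      (hm.continuousAt.eventually hKa.eventually_analyticAt).filter_mono nhdsWithin_le_nhds]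
      with v h1 h2 h3 h4 h5
    have h6 : HasDerivAt (fun v => K (param c (m v))) (η.coeffAt c (m v) * deriv m v) v := by
      rw [← h1]
      exact HasDerivAt.comp v h5.differentiableAt.hasDerivAt h3.differentiableAt.hasDerivAt
    exact (h6.sub h4.differentiableAt.hasDerivAt).deriv.trans (by rw [h2])
  constructor
  · rintro ⟨⟨K, hK⟩, h⟩
    have h1 := eventually_nhds_param.1 (h G K hG hK)
    rw [hHw] at hK h1
    have h2 : ∀ᶠ v in 𝓝 w, K (param c (m v)) - G (param b v) =
        K (param c (m w)) - G (param b w) := by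
      filter_upwards [h1, hHm] with v h3 h4
      rw [← h4, h3]
    -- A constant `m` would make `G` locally constant, hence `η` locally zero.
    have hnc : ¬ EventuallyConst m (𝓝 w) := by
      intro hc
      refine hGn ?_
      have h3 : ∀ᶠ v in 𝓝 w, G (param b v) = G (param b w) := by
        filter_upwards [h2, eventuallyConst_iff_analyticOrderAt_sub_eq_top.1 hc
          |> analyticOrderAt_eq_top.1] with v h4 h5
        rw [sub_eq_zero.1 h5] at h4
        exact sub_right_injective h4
      filter_upwards [hGd, h3.eventually_nhds.filter_mono nhdsWithin_le_nhds] with v h4 h5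
      rw [← h4, EventuallyEq.deriv_eq h5, deriv_const]
    filter_upwards [hderiv hnc K hK, h2.eventually_nhds.filter_mono nhdsWithin_le_nhds] with v h4 h5
    rw [EventuallyEq.deriv_eq h5, deriv_const] at h4
    exact (sub_eq_zero.1 h4.symm)
  · intro h
    have hnc : ¬ EventuallyConst m (𝓝 w) := by
      intro hc
      refine hGn ?_
      have h5 := analyticOrderAt_eq_top.1 (eventuallyConst_iff_analyticOrderAt_sub_eq_top.1 hc)
      have h6 : ∀ᶠ v in 𝓝 w, m v = m w := h5.mono fun v hv => sub_eq_zero.1 hv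
      filter_upwards [h, h6.eventually_nhds.filter_mono nhdsWithin_le_nhds] with v h7 h8
      rw [← h7, EventuallyEq.deriv_eq h8, deriv_const, mul_zero]
    -- The pullback of `η` equals the derivative of the analytic `G` near `w`, so it has no pole and
    -- the target is regular.
    have hreg : param c (m w) ∉ η.poles := by
      rw [param_mem_poles]
      intro hpole
      have h1 := meromorphicOrderAt_comp_mul_deriv_neg hm hnc (η.meromorphic_coeffAt c _) hpole
      have h2 : (fun v => η.coeffAt c (m v) * deriv m v) =ᶠ[𝓝[≠] w]
          deriv fun v => G (param b v) := by
        filter_upwards [h, hGd] with v h3 h4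
        rw [h3, h4]
      rw [meromorphicOrderAt_congr h2] at h1
      exact not_lt.2 hGa.deriv.meromorphicOrderAt_nonneg h1
    obtain ⟨K, hK⟩ := exists_isPrimitiveAt hreg
    refine preservedAt_of_exists hHc hG (hHw ▸ hK) (eventually_nhds_param.2 ?_)
    have h1 := (hcomp K hK).eventually_eq_of_deriv_eq_zero (by
      filter_upwards [hderiv hnc K hK, h] with v h2 h3
      rw [h2, h3, sub_self])
    filter_upwards [h1, hHm] with v h2 h3
    rw [h3, h2, hHw]

/-- The identity theorem: if a holomorphic map preserves `η` near one point, then it does so near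
all nearby points. -/
theorem eventually_preservedAt_iff {H : P1 → P1} {p : P1}
    (hH : ContMDiffAt 𝓘(ℂ, ℂ) 𝓘(ℂ, ℂ) ω H p) {G : P1 → ℂ} (hG : η.IsPrimitiveAt G p)
    (hne : ∀ b w, meromorphicOrderAt (η.coeffAt b) w ≠ ⊤) :
    ∀ᶠ q in 𝓝 p, (η.PreservedAt H q ↔ η.PreservedAt H p) := by
  obtain ⟨b, z, -, rfl⟩ := exists_param p
  obtain ⟨c, y, -, hy⟩ := exists_param (H (param b z))
  set m : ℂ → ℂ := fun v => coordAt c (H (param b v)) with hmdef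
  have hm : AnalyticAt ℂ m z := by
    have h1 : ContMDiffAt 𝓘(ℂ, ℂ) 𝓘(ℂ, ℂ) ω (fun q => coordAt c (H q)) (param b z) :=
      ContMDiffAt.comp (g := coordAt c) (param b z) (hy ▸ contMDiffAt_coordAt c y) hH
    exact contMDiffAt_iff_analyticAt_comp_param.1 h1
  have hHm : ∀ᶠ v in 𝓝 z, H (param b v) = param c (m v) := by
    have h1 := param_coordAt_eventually c y
    rw [hy] at h1
    exact ((hH.continuousAt.eventually h1).mono fun q hq => hq.symm)
      |> eventually_nhds_param.1
  have hev : ∀ᶠ w in 𝓝 z, AnalyticAt ℂ m w ∧ (∀ᶠ v in 𝓝 w, H (param b v) = param c (m v)) ∧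
      η.IsPrimitiveAt G (param b w) := by
    filter_upwards [hm.eventually_analyticAt, hHm.eventually_nhds,
      eventually_nhds_param.1 hG.eventually] with w h1 h2 h3 using ⟨h1, h2, h3⟩
  obtain ⟨r, hr, hball⟩ := Metric.eventually_nhds_iff_ball.1 hev
  have hmer : MeromorphicOn (fun v => η.coeffAt c (m v) * deriv m v - η.coeffAt b v)
      (Metric.ball z r) := fun w hw =>
    (((η.meromorphic_coeffAt c (m w)).comp_analyticAt (hball w hw).1).mul
      (hball w hw).1.deriv.meromorphicAt).sub (η.meromorphic_coeffAt b w)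
  -- Preservation becomes infinite order of the meromorphic difference `H^*η - η`, which on a
  -- connected disc holds everywhere or nowhere.
  have hiff : ∀ w ∈ Metric.ball z r, (η.PreservedAt H (param b w) ↔
      meromorphicOrderAt (fun v => η.coeffAt c (m v) * deriv m v - η.coeffAt b v) w = ⊤) := by
    intro w hw
    rw [preservedAt_param_iff (hball w hw).1 (hball w hw).2.1 (hball w hw).2.2 hne,
      meromorphicOrderAt_eq_top_iff]
    simp only [sub_eq_zero]
  have hz : z ∈ Metric.ball z r := Metric.mem_ball_self hr
  have hpre : IsPreconnected (Metric.ball z r) := (convex_ball z r).isPreconnected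
  rw [eventually_nhds_param]
  filter_upwards [Metric.ball_mem_nhds z hr] with w hw
  rw [hiff w hw, hiff z hz]
  constructor
  · contrapose
    exact fun h => hmer.meromorphicOrderAt_ne_top_of_isPreconnected hpre hz hw h
  · contrapose
    exact fun h => hmer.meromorphicOrderAt_ne_top_of_isPreconnected hpre hw hz h

end MeromorphicOneForm

/-! ### The main theorem. -/

open MeromorphicOneForm

theorem mainTheorem9 (η : MeromorphicOneForm) (x₀ x₁ : P1) (h : P1 → P1)
    (τ : C(I, P1)) (H : I → P1 → P1)
    (hadm : IsAdmissibleGerm η x₀ x₁ (τ 0) h)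
    (hτ : ∀ t, τ t ∉ η.poles)
    (hcont : IsAnalyticContinuation τ h H)
    (hbihol : IsLocalDiffeomorphAt 𝓘(ℂ, ℂ) 𝓘(ℂ, ℂ) ω (H 1) (τ 1)) :
    IsLeafwiseTransport η x₀ x₁ (τ 1) (H 1) ∧
      (IsTransverseAt η x₀ (τ 1) → IsAdmissibleGerm η x₀ x₁ (τ 1) (H 1)) := by
  obtain ⟨htr₀, htr₁, htransport⟩ := hadm
  obtain ⟨hH0, hHhol, hHloc⟩ := hcont
  have hx₀ := htr₀.ne_infty
  have hx₁ := htr₁.ne_infty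
  have hprim : ∀ t, ∃ G, η.IsPrimitiveAt G (τ t) := fun t => exists_isPrimitiveAt (hτ t)
  obtain ⟨G₀, hG₀⟩ := hprim 0
  -- Transversality at the starting point rules out `η = 0`, as the identity theorem for
  -- preservation requires.
  have hne := hG₀.meromorphicOrderAt_ne_top ((isTransverseAt_iff hx₀ hG₀).1 htr₀)
  -- all the germs `H t` preserve `η`
  have hpres : ∀ t, η.PreservedAt (H t) (τ t) := by
    refine forall_unitInterval_of_eventually_iff (fun t => ?_) ?_
    · obtain ⟨G, hG⟩ := hprim t
      filter_upwards [hHloc t,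
        τ.continuous.continuousAt.eventually (eventually_preservedAt_iff (hHhol t) hG hne)]
        with s h1 h2
      exact (Iff.intro (fun h => h.congr h1) (fun h => h.congr h1.symm)).trans h2
    · obtain ⟨⟨-, K, hK⟩, h1⟩ := htransport.preserves hx₀ hG₀
      have hcont : ContinuousAt h (τ 0) := (hHhol 0).continuousAt.congr hH0
      exact (preservedAt_of_exists hcont hG₀ hK (h1 K hK)).congr hH0.symm
  -- local leafwise transport along `τ`
  have hlocal : ∀ t, ∃ D ∈ 𝓝 (τ t), ∀ q ∈ D, ∀ q' ∈ D,
      (∃ γ, IsHorizontal η γ ∧ γ 0 = (x₀, q) ∧ γ 1 = (x₁, H t q)) →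
      IsLeafwiseTransport η x₀ x₁ q' (H t) := by
    intro t
    obtain ⟨G, hG⟩ := hprim t
    obtain ⟨⟨K, hK⟩, h1⟩ := hpres t
    have hc : ∀ᶠ q in 𝓝 (τ t), ContinuousAt (H t) q :=
      ((contMDiffAt_iff_contMDiffAt_nhds (by simp)).1 (hHhol t)).mono fun q hq => hq.continuousAt
    exact exists_nhds_isLeafwiseTransport hG hK hc (h1 G K hG hK) x₀ x₁
  have hsingle : ∀ (q : P1) (F : P1 → P1), (∃ G, η.IsPrimitiveAt G q) →
      IsLeafwiseTransport η x₀ x₁ q F →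
      ∃ γ, IsHorizontal η γ ∧ γ 0 = (x₀, q) ∧ γ 1 = (x₁, F q) := by
    rintro q F hq ⟨U, hU, Γ, -, hΓ⟩
    obtain ⟨h1, h2, h3⟩ := hΓ q (mem_of_mem_nhds hU)
    exact ⟨Γ q, h1.isHorizontal (by rw [h2]; exact ⟨hx₀, hq⟩), h2, h3⟩
  -- Near `t`, paths over `τ s` and `τ t` produce each other through `hlocal`, because both points
  -- lie in `D` and `H s` has the same germ as `H t` at `τ s`.
  have hpath : ∀ t, ∃ γ, IsHorizontal η γ ∧ γ 0 = (x₀, τ t) ∧ γ 1 = (x₁, H t (τ t)) := by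
    refine forall_unitInterval_of_eventually_iff (fun t => ?_) ?_
    · obtain ⟨D, hD, hDtr⟩ := hlocal t
      filter_upwards [hHloc t, τ.continuous.continuousAt.eventually hD] with s h1 h2
      rw [h1.self_of_nhds]
      exact ⟨fun h => hsingle _ _ (hprim t) (hDtr _ h2 _ (mem_of_mem_nhds hD) h),
        fun h => hsingle _ _ (hprim s) (hDtr _ (mem_of_mem_nhds hD) _ h2 h)⟩
    · rw [hH0.self_of_nhds]
      exact hsingle _ _ (hprim 0) htransport
  have hfinal : IsLeafwiseTransport η x₀ x₁ (τ 1) (H 1) := by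
    obtain ⟨D, hD, hDtr⟩ := hlocal 1
    exact hDtr _ (mem_of_mem_nhds hD) _ (mem_of_mem_nhds hD) (hpath 1)
  refine ⟨hfinal, fun htr => ⟨htr, ?_, hfinal⟩⟩
  obtain ⟨G, hG⟩ := hprim 1
  obtain ⟨⟨K, hK⟩, h1⟩ := hpres 1
  rw [isTransverseAt_iff hx₁ hK]
  -- If `dK` vanished at the target, then so would `d(K ∘ H 1) = dG` at `τ 1`, against
  -- transversality at the source.
  intro hK0
  refine (isTransverseAt_iff hx₀ hG).1 htr ?_
  have hKH : ContMDiffAt 𝓘(ℂ, ℂ) 𝓘(ℂ, ℂ) ω (fun q => K (H 1 q)) (τ 1) :=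
    ContMDiffAt.comp (g := K) (τ 1) hK.1 (hHhol 1)
  have hKH0 : mfderiv 𝓘(ℂ, ℂ) 𝓘(ℂ, ℂ) (fun q => K (H 1 q)) (τ 1) = 0 :=
    (mfderiv_comp (g := K) (τ 1) (hK.1.mdifferentiableAt (by simp))
      ((hHhol 1).mdifferentiableAt (by simp))).trans
      ((congrArg (fun l : ℂ →L[ℂ] ℂ => l.comp _) hK0).trans (ContinuousLinearMap.zero_comp _))
  have hKG := h1 G K hG hK
  have hGs := hG.1
  obtain ⟨b, z, -, hz⟩ := exists_param (τ 1)
  rw [← hz] at hKH hKH0 hKG hGs ⊢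
  rw [mfderiv_param_eq_zero_iff hKH] at hKH0
  rw [mfderiv_param_eq_zero_iff hGs, ← hKH0]
  have e : (fun w => G (param b w)) =ᶠ[𝓝 z] fun w =>
      K (H 1 (param b w)) - (K (H 1 (param b z)) - G (param b z)) := by
    filter_upwards [eventually_nhds_param.1 hKG] with w hw
    rw [← hw, sub_sub_cancel]
  rw [e.deriv_eq, deriv_sub_const]
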